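/- Let $n\ge 0$, let $B_r$ be the open Euclidean ball of radius $r$ about $0$ in $\mathbb R^{n+1}$, let $B(\xi,r)$ be the open Euclidean ball of radius $r$ about $\xi$, and let $G(n,n+1)$ be the Grassmannian of unoriented $n$-dimensional linear subspaces of $\mathbb R^{n+1}$. For a Riemannian metric $\tilde g$ of class $C^1$ on $B_3$ write $\|\tilde g-g_{eucl}\|_{C^1(B_3)}\le\eta$ if $\|\tilde g_x-g_{eucl}\|\le\eta$ and $\|D\tilde g_x\|\le\eta$ for all $x\in B_3$ (operator norms with respect to the Euclidean norm). An $n$-varifold $V$ in $B_3$ is a Radon measure on $B_3\times G(n,n+1)$; $\|V\|$ is its image on $B_3$, and $\|V\|(A)$ means $\|V\|(A\cap B_3)$ for $A\subset\mathbb R^{n+1}$ (likewise for integrals over $A$). For $b\ge0$, $V$ has $b$-bounded first variation with respect to $\tilde g$ if $$\Big|\int_{B_3\times G(n,n+1)}\mathrm{div}^{\tilde g}_S X(x)\,dV(x,S)\Big|\le b\int_{B_3}|X|_{\tilde g}\,d\|V\|$$ for every compactly supported $C^1$ vector field $X$ on $B_3$, where $\mathrm{div}^{\tilde g}_S X=\sum_{i=1}^n\tilde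 g(\tilde\nabla_{e_i}X,e_i)$ for a $\tilde g$-orthonormal basis $e_1,\dots,e_n$ of $S$ and the Levi-Civita connection $\tilde\nabla$ of $\tilde g$. Then there are real numbers $\mathfrak a=\mathfrak a(\eta,b)\ge 0$ and $\mathfrak c=\mathfrak c(\eta,b)\ge 0$, for $\eta\in(0,1)$ and $b\ge 0$ (depending only on $n$, $\eta$ and $b$), with the following properties. 1. Let $\eta\in(0,1)$ and $b\ge0$, let $\tilde g$ be a $C^1$ metric on $B_3$ with $\|\tilde g-g_{eucl}\|_{C^1(B_3)}\le\eta$, and let $V$ be an $n$-varifold in $B_3$ with $b$-bounded first variation with respect to $\tilde g$. Then for all $\xi\in B_1$ and $0<\sigma\le\rho<1$, $$e^{\mathfrak c\sigma}\,\frac{\|V\|(B(\xi,\sigma))}{\sigma^n}\le(1+\mathfrak a)\,e^{\mathfrak c(1+\mathfrak a)\rho}\,\frac{\|V\|(B(\xi,(1+\mathfrak a)\rho))}{\rho^n},$$ and, for every smooth nonnegative function $h$ on $B_3$, $$\frac{e^{\mathfrak c\sigma}}{\sigma^n}\int_{B(\xi,\sigma)}h\,d\|V\|\le(1+\mathfrak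 a)\,e^{\mathfrak c(1+\mathfrak a)\rho}\left[\frac1{\rho^n}\int_{B(\xi,(1+\mathfrak a)\rho)}h\,d\|V\|+\int_\sigma^{(1+\mathfrak a)\rho}\int_{B(\xi,\tau)\times G(n,n+1)}\frac{|\nabla_S h|(x)}{\tau^n}\,dV(x,S)\,d\tau\right],$$ where $|\nabla_S h|$ is the Euclidean norm of the Euclidean orthogonal projection of the gradient of $h$ to $S$; the right-hand sides may be $+\infty$. 2. As $\eta\to0^+$, $\mathfrak a(\eta,b)\to0$ and $|\mathfrak c(\eta,b)-b|\to0$, uniformly in $b\in[0,\infty)$. -/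

import Mathlib

set_option maxSynthPendingDepth 3

open MeasureTheory Set Filter Topology Metric
open scoped ContDiff ENNReal

namespace VarifoldMonotonicity

noncomputable section

/-- The ambient Euclidean space of dimension `n + 1`. -/
abbrev E (n : ℕ) : Type := EuclideanSpace ℝ (Fin (n + 1))

/-- The Grassmannian `G(n, n+1)` of unoriented `n`-dimensional linear subspaces. -/
def Gr (n : ℕ) : Type := {S : Submodule ℝ (E n) // Module.finrank ℝ S = n}

/-- The topology of the Grassmannian is the one given by identifying a plane with its Euclidean
orthogonal projection. -/
instance instTopologicalSpaceGr (n : ℕ) : TopologicalSpace (Gr n) :=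
  TopologicalSpace.induced (fun S : Gr n => (S.1.starProjection : E n →L[ℝ] E n)) inferInstance

instance instMeasurableSpaceGr (n : ℕ) : MeasurableSpace (Gr n) := borel (Gr n)

instance instBorelSpaceGr (n : ℕ) : BorelSpace (Gr n) := ⟨rfl⟩

/-- An `n`-varifold in `U`: a Radon measure on `U × G(n, n+1)`.  (For open `U` this space is locally
compact with a countable base, so that a Borel measure is Radon exactly if it is locally finite.) -/
structure Varifold (n : ℕ) (U : Set (E n)) where
  measure : Measure (U × Gr n)
  locallyFinite : IsLocallyFiniteMeasure measure

/-- The weight `‖V‖` (also written `μ_V`), the image of `V` under `(x, S) ↦ x`, regarded as a measure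
on the whole Euclidean space that is concentrated on `U`. -/
def Varifold.mass {n : ℕ} {U : Set (E n)} (V : Varifold n U) : Measure (E n) :=
  V.measure.map (fun p => (p.1 : E n))

/-- A field of bilinear forms on the Euclidean space. -/
abbrev BilinField (n : ℕ) : Type := E n → E n →L[ℝ] E n →L[ℝ] ℝ

/-- `g` is a Riemannian metric of class `C¹` on `U`. -/
structure IsMetricOn {n : ℕ} (U : Set (E n)) (g : BilinField n) : Prop where
  contDiffOn : ContDiffOn ℝ 1 g U
  symm : ∀ x ∈ U, ∀ v w, g x v w = g x w v
  pos : ∀ x ∈ U, ∀ v, v ≠ 0 → 0 < g x v v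

/-- The Euclidean metric at a point. -/
def euclid (n : ℕ) : E n →L[ℝ] E n →L[ℝ] ℝ := innerSL ℝ

theorem euclid_apply (n : ℕ) (v w : E n) : euclid n v w = inner ℝ v w := rfl

/-- `‖g - g_eucl‖_{C¹(U)} ≤ η`, with the operator norms of the bilinear form `g x - g_eucl` and of the
derivative of `g`, and with the larger one of the two suprema as the `C¹` norm (so that the condition
is implied by the one for their sum). -/
def C1CloseToEuclid {n : ℕ} (U : Set (E n)) (g : BilinField n) (η : ℝ) : Prop :=
  ∀ x ∈ U, ‖g x - euclid n‖ ≤ η ∧ ‖fderiv ℝ g x‖ ≤ η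

/-- The Christoffel symbols of the first kind: the covector
`z ↦ ½ (∂_v g (w, z) + ∂_w g (v, z) - ∂_z g (v, w))` at `x`. -/
def christoffelFirst {n : ℕ} (g : BilinField n) (x v w : E n) : E n →L[ℝ] ℝ :=
  (1 / 2 : ℝ) • (fderiv ℝ g x v w + fderiv ℝ g x w v - ((fderiv ℝ g x).flip v).flip w)

/-- The Christoffel symbols of the second kind, as a vector: the covector above is turned into a
vector by the inverse of `g x`. -/
def christoffel {n : ℕ} (g : BilinField n) (x v w : E n) : E n :=
  (g x).inverse (christoffelFirst g x v w)

/-- The inverse in the definition is a true one where `g` is positive definite. -/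
theorem apply_christoffel {n : ℕ} {U : Set (E n)} {g : BilinField n} (hg : IsMetricOn U g) {x : E n}
    (hx : x ∈ U) (v w : E n) : g x (christoffel g x v w) = christoffelFirst g x v w := by
  have inj : Function.Injective (g x : E n →ₗ[ℝ] (E n →L[ℝ] ℝ)) := by
    rw [injective_iff_map_eq_zero]
    intro v hv
    by_contra h
    have h0 := hg.pos x hx v h
    rw [ContinuousLinearMap.coe_coe] at hv
    simp [hv] at h0
  have hd : Module.finrank ℝ (E n) = Module.finrank ℝ (E n →L[ℝ] ℝ) := by
    rw [← (LinearMap.toContinuousLinearMap (𝕜 := ℝ) (E := E n) (F' := ℝ)).finrank_eq]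
    exact (Subspace.dual_finrank_eq).symm
  let e := (LinearEquiv.ofInjectiveOfFinrankEq _ inj hd).toContinuousLinearEquiv
  have he : g x = (e : E n →L[ℝ] (E n →L[ℝ] ℝ)) := by ext; rfl
  rw [christoffel, he, ContinuousLinearMap.inverse_equiv]
  exact e.apply_symm_apply _

/-- The Levi-Civita covariant derivative `∇_v X` at `x`. -/
def covDeriv {n : ℕ} (g : BilinField n) (X : E n → E n) (x v : E n) : E n :=
  fderiv ℝ X x v + christoffel g x v (X x)

/-- `e` is a basis of `S` that is orthonormal for the bilinear form `B`. -/
def IsONBasis {n : ℕ} (B : E n →L[ℝ] E n →L[ℝ] ℝ) (S : Submodule ℝ (E n)) (e : Fin n → E n) : Prop :=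
  Submodule.span ℝ (range e) = S ∧ ∀ i j, B (e i) (e j) = if i = j then 1 else 0

open Classical in
/-- The divergence `div_S X = ∑ᵢ g (∇_{eᵢ} X, eᵢ)` of `X` at `x` along the `n`-plane `S`, where
`e₁, …, eₙ` is a `g`-orthonormal basis of `S`.  The basis exists (`exists_isONBasis`), and the value
does not depend on it (`divergence_eq`). -/
def divergence {n : ℕ} (g : BilinField n) (X : E n → E n) (x : E n) (S : Gr n) : ℝ :=
  if h : ∃ e : Fin n → E n, IsONBasis (g x) S.1 e then
    ∑ i, g x (covDeriv g X x (h.choose i)) (h.choose i)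
  else 0

/-- The first variation `δV(X) = ∫ div_S X dV(x, S)` with respect to the metric `g`. -/
def Varifold.firstVariation {n : ℕ} {U : Set (E n)} (V : Varifold n U) (g : BilinField n)
    (X : E n → E n) : ℝ :=
  ∫ p, divergence g X (p.1 : E n) p.2 ∂V.measure

/-- `V` has `b`-bounded first variation with respect to `g`: `|δV(X)| ≤ b ∫ |X|_g d‖V‖` for every
compactly supported `C¹` vector field `X` on `U`. -/
def Varifold.HasBoundedFirstVariation {n : ℕ} {U : Set (E n)} (V : Varifold n U) (g : BilinField n)
    (b : ℝ) : Prop :=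
  ∀ X : E n → E n, ContDiff ℝ 1 X → HasCompactSupport X → tsupport X ⊆ U →
    |V.firstVariation g X| ≤ b * ∫ x, Real.sqrt (g x (X x) (X x)) ∂V.mass

/-- `|∇_S h|` at `x`: the Euclidean norm of the Euclidean orthogonal projection to `S` of the
Euclidean gradient of `h`. -/
def tangentialGradNorm {n : ℕ} (h : E n → ℝ) (x : E n) (S : Gr n) : ℝ :=
  ‖S.1.starProjection (gradient h x)‖

theorem exists_basis_of_core {W : Type*} [AddCommGroup W] [Module ℝ W] [FiniteDimensional ℝ W]
    (core : InnerProductSpace.Core ℝ W) {n : ℕ} (hn : Module.finrank ℝ W = n) :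
    ∃ o : Module.Basis (Fin n) ℝ W, ∀ i j, core.inner (o i) (o j) = if i = j then 1 else 0 := by
  let i1 : NormedAddCommGroup W := @InnerProductSpace.Core.toNormedAddCommGroup ℝ W _ _ _ core
  let i2 : InnerProductSpace ℝ W := InnerProductSpace.ofCore core.toCore
  let o : OrthonormalBasis (Fin n) ℝ W := (stdOrthonormalBasis ℝ W).reindex (finCongr hn)
  exact ⟨o.toBasis, fun i j => by
    simpa using orthonormal_iff_ite.mp o.orthonormal i j⟩

/-- A plane has an orthonormal basis for every positive definite symmetric bilinear form. -/
theorem exists_isONBasis {n : ℕ} (B : E n →L[ℝ] E n →L[ℝ] ℝ) (hs : ∀ v w, B v w = B w v)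
    (hp : ∀ v, v ≠ 0 → 0 < B v v) (S : Gr n) : ∃ e : Fin n → E n, IsONBasis B S.1 e := by
  let core : InnerProductSpace.Core ℝ S.1 :=
    { inner := fun v w => B (v : E n) (w : E n)
      conj_inner_symm := fun v w => by simpa using hs _ _
      re_inner_nonneg := fun v => by
        by_cases hv : (v : E n) = 0
        · simp [hv]
        · simpa using (hp _ hv).le
      add_left := fun u v w => by simp
      smul_left := fun u v r => by simp
      definite := fun v hv => by
        by_contra hne
        exact (hp (v : E n) (by simpa using hne)).ne' hv }
  obtain ⟨o, ho⟩ := exists_basis_of_core core S.2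
  refine ⟨fun i => (o i : E n), ?_, ho⟩
  have h2 := congrArg (Submodule.map S.1.subtype) o.span_eq
  rw [Submodule.map_span, ← range_comp, Submodule.map_top, Submodule.range_subtype] at h2
  simpa [Function.comp_def] using h2

/-- The trace of a bilinear form over an orthonormal basis does not depend on the basis. -/
theorem sum_eq_of_isONBasis {n : ℕ} (B : E n →L[ℝ] E n →L[ℝ] ℝ)
    (S : Submodule ℝ (E n)) {e e' : Fin n → E n} (he : IsONBasis B S e) (he' : IsONBasis B S e')
    (L : E n →ₗ[ℝ] E n) : ∑ i, B (L (e i)) (e i) = ∑ i, B (L (e' i)) (e' i) := by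
  have exp : ∀ v ∈ S, v = ∑ j, B v (e j) • e j := by
    intro v hv
    rw [← he.1, Submodule.mem_span_range_iff_exists_fun] at hv
    obtain ⟨c, rfl⟩ := hv
    refine Finset.sum_congr rfl fun j _ => ?_
    simp [map_sum, he.2]
  have mem : ∀ i, e' i ∈ S := fun i => by
    rw [← he'.1]; exact Submodule.subset_span ⟨i, rfl⟩
  let O : Matrix (Fin n) (Fin n) ℝ := fun i j => B (e' i) (e j)
  have h1 : O * O.transpose = 1 := by
    ext i k
    rw [Matrix.mul_apply, Matrix.one_apply, ← he'.2 i k]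
    conv_rhs => rw [exp _ (mem k)]
    simp only [map_sum, map_smul, smul_eq_mul, O]
    exact Finset.sum_congr rfl fun j _ => mul_comm _ _
  have h2 : O.transpose * O = 1 := mul_eq_one_comm.mp h1
  have h3 : ∀ j k, ∑ i, B (e' i) (e j) * B (e' i) (e k) = if j = k then 1 else 0 := by
    intro j k
    have := congrFun (congrFun h2 j) k
    rwa [Matrix.mul_apply, Matrix.one_apply] at this
  have h4 : ∀ i, B (L (e' i)) (e' i)
      = ∑ j, ∑ k, (B (e' i) (e j) * B (e' i) (e k)) * B (L (e j)) (e k) := by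
    intro i
    conv_lhs => rw [exp _ (mem i)]
    simp only [map_sum, map_smul, _root_.sum_apply, _root_.smul_apply,
      smul_eq_mul, Finset.mul_sum]
    rw [Finset.sum_comm]
    exact Finset.sum_congr rfl fun j _ => Finset.sum_congr rfl fun k _ => by ring
  simp_rw [h4]
  rw [Finset.sum_comm]
  refine Finset.sum_congr rfl fun j _ => ?_
  rw [Finset.sum_comm]
  simp_rw [← Finset.sum_mul, h3]
  simp

theorem christoffelFirst_add {n : ℕ} (g : BilinField n) (x v v' w : E n) :
    christoffelFirst g x (v + v') w = christoffelFirst g x v w + christoffelFirst g x v' w := by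
  ext z
  simp only [christoffelFirst, map_add, _root_.add_apply, _root_.sub_apply, _root_.smul_apply,
    ContinuousLinearMap.flip_apply, smul_eq_mul]
  ring

theorem christoffelFirst_smul {n : ℕ} (g : BilinField n) (x v w : E n) (r : ℝ) :
    christoffelFirst g x (r • v) w = r • christoffelFirst g x v w := by
  ext z
  simp only [christoffelFirst, map_smul, _root_.add_apply, _root_.sub_apply, _root_.smul_apply,
    ContinuousLinearMap.flip_apply, smul_eq_mul]
  ring

/-- The divergence can be computed in every orthonormal basis of the plane. -/
theorem divergence_eq {n : ℕ} (g : BilinField n) (X : E n → E n) (x : E n) (S : Gr n)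
    {e : Fin n → E n} (he : IsONBasis (g x) S.1 e) :
    divergence g X x S = ∑ i, g x (covDeriv g X x (e i)) (e i) := by
  have h : ∃ e : Fin n → E n, IsONBasis (g x) S.1 e := ⟨e, he⟩
  let L : E n →ₗ[ℝ] E n :=
    { toFun := covDeriv g X x
      map_add' := fun v w => by
        simp only [covDeriv, christoffel, christoffelFirst_add, map_add]
        abel
      map_smul' := fun r v => by
        simp only [covDeriv, christoffel, christoffelFirst_smul, map_smul, smul_add,
          RingHom.id_apply] }
  rw [divergence, dif_pos h]
  exact sum_eq_of_isONBasis (g x) S.1 h.choose_spec he L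

end

end VarifoldMonotonicity

namespace VarifoldMonotonicity

noncomputable section

/-! The classical proof tests the first variation with a cut-off multiple of the position field `x -
ξ` and integrates the resulting differential inequality in the radius. The metric is only `C¹`, so
distances are measured by the frozen metric `g ξ`: write `y = x - ξ`, `q = g ξ y y / (1 - η)`, and
take `X = f y` with `f = h φ(q / t²)`.

Let `T` be the `g x`-orthogonal projection of `y` to `S`. Then `div_S X = df(T) + n f + f Γ`, where
`Γ` collects Christoffel symbols and is `O(η |y|)`. The radial part of `df(T)` contains `g ξ y T`.
Since `g x - g ξ` is at most `η |y|`, this is at most `(1 + O(η) |y|) g ξ y y`, and so the radial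
part is controlled by `t ∂_t f` with relative error `m = O(η) t`. Freezing matters here: a relative
error `O(η)` without the factor `t` would cost a power of the radius, while `O(η) t` only changes
the exponential rate (`radial_apply_tangential_le`, `mul_localized_le`).

With `F(t) = ∫ f dV`, the bound on the first variation gives `n F / t ≤ β F + (1 + m) F' + L G`,
where `β = b (1 + η) + 3/2 n η / (1 - η)`, `L = (1 + 2η) / (1 - η)` and `G` is the integral of `|∇_S
h|` over `ball ξ t`. Hence `exp(γ t) t⁻ⁿ F(t)` is almost increasing
(`Varifold.exp_mul_localMass_le`).

The sets `q < t²` are ellipsoids. They lie in `ball ξ t`, and `ball ξ σ` lies in the one of size `L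
σ`, with room for a smooth cut-off. Comparing balls costs `Lⁿ`, and the gradient term one more
factor `L`; this and the replacement of `b (1 + η)` by `b` in the rate are absorbed in `1 + a = (1 +
η) Lⁿ⁺¹` (`Varifold.weighted_monotonicity`).

A Bochner integral of a non-integrable function is `0`, so the first variation can be used only once
the divergence is known to be integrable. That is the purpose of the compactness of the Grassmannian
and of `continuous_divergence`. -/

/-! ### Compactness of the Grassmannian -/

theorem continuous_starProjection (n : ℕ) :
    Continuous (fun S : Gr n => (S.1.starProjection : E n →L[ℝ] E n)) :=
  continuous_induced_dom

theorem trace_starProjection {n : ℕ} (S : Submodule ℝ (E n)) :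
    LinearMap.trace ℝ (E n) (S.starProjection : E n →ₗ[ℝ] E n) = Module.finrank ℝ S := by
  have hp : LinearMap.IsProj S (S.starProjection : E n →ₗ[ℝ] E n) :=
    ⟨fun x => S.starProjection_apply_mem x,
      fun x hx => Submodule.starProjection_eq_self_iff.mpr hx⟩
  exact hp.trace

/-- The Grassmannian is compact: its image is the closed and bounded set of the orthogonal
projections of trace `n`. -/
instance instCompactSpaceGr (n : ℕ) : CompactSpace (Gr n) := by
  have hind : IsInducing (fun S : Gr n => (S.1.starProjection : E n →L[ℝ] E n)) := ⟨rfl⟩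
  have himg : (fun S : Gr n => (S.1.starProjection : E n →L[ℝ] E n)) '' univ
      = closedBall (0 : E n →L[ℝ] E n) 1 ∩ ({P : E n →L[ℝ] E n | P * P = P} ∩ ({P | star P = P} ∩
        {P | LinearMap.trace ℝ (E n) (P : E n →ₗ[ℝ] E n) = n})) := by
    ext P
    constructor
    · rintro ⟨S, -, rfl⟩
      refine ⟨by simpa using S.1.starProjection_norm_le, ?_, ?_, ?_⟩
      · exact (isStarProjection_iff_eq_starProjection.mpr
          ⟨S.1, inferInstance, rfl⟩ : IsStarProjection S.1.starProjection).isIdempotentElem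
      · exact (isStarProjection_iff_eq_starProjection.mpr
          ⟨S.1, inferInstance, rfl⟩ : IsStarProjection S.1.starProjection).isSelfAdjoint
      · simp only [mem_ofPred_eq]
        rw [trace_starProjection, S.2]
    · rintro ⟨-, h1, h2, h3⟩
      obtain ⟨K, hK, rfl⟩ := isStarProjection_iff_eq_starProjection.mp
        (⟨h1, h2⟩ : IsStarProjection P)
      refine ⟨⟨K, ?_⟩, trivial, rfl⟩
      have h4 := trace_starProjection K
      rw [mem_ofPred_eq] at h3
      exact_mod_cast h4.symm.trans h3
  have htr : Continuous (fun P : E n →L[ℝ] E n =>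
      LinearMap.trace ℝ (E n) (P : E n →ₗ[ℝ] E n)) :=
    (LinearMap.trace ℝ (E n) ∘ₗ
      (ContinuousLinearMap.coeLM ℝ : (E n →L[ℝ] E n) →ₗ[ℝ] _)).continuous_of_finiteDimensional
  have : ProperSpace (E n →L[ℝ] E n) := FiniteDimensional.proper ℝ _
  refine ⟨hind.isCompact_iff.mpr ?_⟩
  rw [himg]
  refine (isCompact_closedBall _ _).inter_right (IsClosed.inter ?_ (IsClosed.inter ?_ ?_))
  · exact isClosed_eq (continuous_id.mul continuous_id) continuous_id
  · exact isClosed_eq continuous_star continuous_id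
  · exact isClosed_eq htr continuous_const

/-! ### Basis-free traces over planes; continuity and integrability of the divergence -/

/-- A linear map from the Euclidean space to its dual that is positive on the diagonal is
invertible. -/
theorem exists_continuousLinearEquiv_of_pos {n : ℕ} (M : E n →L[ℝ] E n →L[ℝ] ℝ)
    (hM : ∀ v, v ≠ 0 → 0 < M v v) : ∃ e : E n ≃L[ℝ] (E n →L[ℝ] ℝ), M = e := by
  have inj : Function.Injective (M : E n →ₗ[ℝ] (E n →L[ℝ] ℝ)) := by
    rw [injective_iff_map_eq_zero]
    intro v hv
    by_contra h
    have h0 := hM v h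
    rw [ContinuousLinearMap.coe_coe] at hv
    simp [hv] at h0
  have hd : Module.finrank ℝ (E n) = Module.finrank ℝ (E n →L[ℝ] ℝ) := by
    rw [← (LinearMap.toContinuousLinearMap (𝕜 := ℝ) (E := E n) (F' := ℝ)).finrank_eq]
    exact (Subspace.dual_finrank_eq).symm
  exact ⟨(LinearEquiv.ofInjectiveOfFinrankEq _ inj hd).toContinuousLinearEquiv, by ext; rfl⟩

/-- The bilinear form that is `B` on the range of the projection `P` and Euclidean on its
orthogonal complement. -/
def planeForm {n : ℕ} (B : E n →L[ℝ] E n →L[ℝ] ℝ) (P : E n →L[ℝ] E n) :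
    E n →L[ℝ] E n →L[ℝ] ℝ :=
  (ContinuousLinearMap.compL ℝ (E n) (E n) ℝ).flip P ∘L ((B - euclid n) ∘L P) + euclid n

theorem planeForm_apply {n : ℕ} (B : E n →L[ℝ] E n →L[ℝ] ℝ) (P : E n →L[ℝ] E n) (v w : E n) :
    planeForm B P v w = B (P v) (P w) - inner ℝ (P v) (P w) + inner ℝ v w := by
  simp [planeForm, euclid_apply]

/-- The operator `w ↦ ∑ᵢ ⟪eᵢ, w⟫ eᵢ` for a `B`-orthonormal basis `e` of the range of `P`. -/
def planeInverse {n : ℕ} (B : E n →L[ℝ] E n →L[ℝ] ℝ) (P : E n →L[ℝ] E n) : E n →L[ℝ] E n :=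
  (planeForm B P).inverse ∘L (euclid n ∘L P)

/-- The Euclidean terms contribute `‖v‖² - ‖P v‖² ≥ 0`, and `B (P v) (P v)` is positive unless `P v
= 0`, when `‖v‖²` remains. Positivity makes the form invertible. -/
theorem planeForm_pos {n : ℕ} {B : E n →L[ℝ] E n →L[ℝ] ℝ} (hp : ∀ v, v ≠ 0 → 0 < B v v)
    (S : Submodule ℝ (E n)) (v : E n) (hv : v ≠ 0) : 0 < planeForm B S.starProjection v v := by
  rw [planeForm_apply, real_inner_self_eq_norm_sq, real_inner_self_eq_norm_sq]
  have h1 : ‖S.starProjection v‖ ≤ ‖v‖ := S.norm_starProjection_apply_le v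
  have h2 := norm_pos_iff.mpr hv
  by_cases h : S.starProjection v = 0
  · simp [h, h2]
  · have h3 := hp _ h
    have : ‖S.starProjection v‖ ^ 2 ≤ ‖v‖ ^ 2 := by gcongr
    linarith

theorem IsONBasis.mem {n : ℕ} {B : E n →L[ℝ] E n →L[ℝ] ℝ} {S : Submodule ℝ (E n)}
    {e : Fin n → E n} (he : IsONBasis B S e) (i : Fin n) : e i ∈ S := by
  rw [← he.1]; exact Submodule.subset_span ⟨i, rfl⟩

theorem IsONBasis.sum_eq {n : ℕ} {B : E n →L[ℝ] E n →L[ℝ] ℝ} {S : Submodule ℝ (E n)}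
    {e : Fin n → E n} (he : IsONBasis B S e) {v : E n} (hv : v ∈ S) :
    ∑ j, B v (e j) • e j = v := by
  rw [← he.1, Submodule.mem_span_range_iff_exists_fun] at hv
  obtain ⟨c, rfl⟩ := hv
  refine Finset.sum_congr rfl fun j _ => ?_
  simp [map_sum, he.2]

theorem planeInverse_apply {n : ℕ} {B : E n →L[ℝ] E n →L[ℝ] ℝ} (hs : ∀ v w, B v w = B w v)
    (hp : ∀ v, v ≠ 0 → 0 < B v v) {S : Submodule ℝ (E n)} {e : Fin n → E n}
    (he : IsONBasis B S e) (w : E n) :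
    planeInverse B S.starProjection w = ∑ i, (inner ℝ (e i) w : ℝ) • e i := by
  obtain ⟨f, hf⟩ := exists_continuousLinearEquiv_of_pos _ (planeForm_pos hp S)
  have hP : ∀ i, S.starProjection (e i) = e i := fun i =>
    Submodule.starProjection_eq_self_iff.mpr (he.mem i)
  -- On vectors of `S` the form acts as `z ↦ B · (P z)`, and expanding `P z` in the basis `e` gives
  -- `⟪w, P z⟫`.
  have key : planeForm B S.starProjection (∑ i, (inner ℝ (e i) w : ℝ) • e i)
      = euclid n (S.starProjection w) := by
    ext z
    have hz := he.sum_eq (S.starProjection_apply_mem z)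
    have h1 : (inner ℝ (S.starProjection w) z : ℝ) = inner ℝ w (S.starProjection z) :=
      S.inner_starProjection_left_eq_right w z
    have h2 : ∀ i, (inner ℝ (e i) z : ℝ) = inner ℝ (e i) (S.starProjection z) := fun i => by
      rw [← S.inner_starProjection_left_eq_right, hP]
    rw [planeForm_apply, euclid_apply, h1]
    simp only [map_sum, map_smul, hP, _root_.sum_apply, _root_.smul_apply, smul_eq_mul,
      sum_inner, real_inner_smul_left, h2, sub_add_cancel]
    conv_rhs => rw [← hz, inner_sum]
    refine Finset.sum_congr rfl fun i _ => ?_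
    rw [real_inner_smul_right, hs (e i), real_inner_comm]
    ring
  rw [planeInverse, ContinuousLinearMap.comp_apply, ContinuousLinearMap.comp_apply, ← key, hf,
    ContinuousLinearMap.inverse_equiv]
  exact f.symm_apply_apply _

/-- The trace over a `B`-orthonormal basis of a plane, through the standard basis. -/
theorem sum_planeInverse {n : ℕ} {B : E n →L[ℝ] E n →L[ℝ] ℝ} (hs : ∀ v w, B v w = B w v)
    (hp : ∀ v, v ≠ 0 → 0 < B v v) {S : Submodule ℝ (E n)} {e : Fin n → E n}
    (he : IsONBasis B S e) (A : E n →ₗ[ℝ] E n →L[ℝ] ℝ) :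
    ∑ i, A (e i) (e i) = ∑ k, A (planeInverse B S.starProjection
      (EuclideanSpace.basisFun (Fin (n + 1)) ℝ k)) (EuclideanSpace.basisFun (Fin (n + 1)) ℝ k) := by
  simp only [planeInverse_apply hs hp he, map_sum, map_smul, _root_.sum_apply,
    _root_.smul_apply, smul_eq_mul]
  rw [Finset.sum_comm]
  refine Finset.sum_congr rfl fun i _ => ?_
  conv_lhs =>
    enter [2]
    rw [← (EuclideanSpace.basisFun (Fin (n + 1)) ℝ).sum_repr' (e i)]
  simp [real_inner_comm]

/-- Orthonormal bases of a plane are chosen arbitrarily and need not vary continuously; this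
operator does, because it is built from `B` and the projection by composition and the inversion of
an invertible map. -/
theorem continuous_planeInverse {n : ℕ} {Y : Type*} [TopologicalSpace Y]
    {B : Y → E n →L[ℝ] E n →L[ℝ] ℝ} (hB : Continuous B) (hp : ∀ y v, v ≠ 0 → 0 < B y v v)
    {S : Y → Gr n} (hS : Continuous S) :
    Continuous fun y => planeInverse (B y) (S y).1.starProjection := by
  have hP : Continuous fun y => ((S y).1.starProjection : E n →L[ℝ] E n) :=
    (continuous_starProjection n).comp hS
  have hF : Continuous fun y => planeForm (B y) (S y).1.starProjection := by
    unfold planeForm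
    fun_prop
  have hI : Continuous fun y => (planeForm (B y) (S y).1.starProjection).inverse := by
    rw [continuous_iff_continuousAt]
    intro y
    obtain ⟨f, hf⟩ := exists_continuousLinearEquiv_of_pos _ (planeForm_pos (hp y) (S y).1)
    have h1 : ContinuousAt (ContinuousLinearMap.inverse : (E n →L[ℝ] E n →L[ℝ] ℝ) → _)
        (planeForm (B y) (S y).1.starProjection) := by
      rw [hf]
      exact (contDiffAt_map_inverse (n := 0) f).continuousAt
    exact ContinuousAt.comp (f := fun y => planeForm (B y) (S y).1.starProjection) h1
      hF.continuousAt
  unfold planeInverse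
  fun_prop

/-- The bilinear form `(v, w) ↦ g (∇_v X, w)` at `x`. -/
def covForm {n : ℕ} (g : BilinField n) (X : E n → E n) (x : E n) : E n →ₗ[ℝ] E n →L[ℝ] ℝ where
  toFun v := g x (fderiv ℝ X x v) + christoffelFirst g x v (X x)
  map_add' v w := by rw [map_add, map_add, christoffelFirst_add]; abel
  map_smul' r v := by rw [map_smul, map_smul, christoffelFirst_smul, smul_add, RingHom.id_apply]

theorem covForm_apply {n : ℕ} (g : BilinField n) (X : E n → E n) (x v w : E n) :
    covForm g X x v w = g x (fderiv ℝ X x v) w + christoffelFirst g x v (X x) w := rfl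

theorem divergence_eq_sum_covForm {n : ℕ} {U : Set (E n)} {g : BilinField n} (hg : IsMetricOn U g)
    (X : E n → E n) {x : E n} (hx : x ∈ U) (S : Gr n) {e : Fin n → E n}
    (he : IsONBasis (g x) S.1 e) : divergence g X x S = ∑ i, covForm g X x (e i) (e i) := by
  rw [divergence_eq g X x S he]
  refine Finset.sum_congr rfl fun i _ => ?_
  rw [covDeriv, map_add, _root_.add_apply, apply_christoffel hg hx, covForm_apply]

/-- The trace over the chosen basis is rewritten by `sum_planeInverse` over the fixed standard
basis, where every ingredient is continuous in `(x, S)`. The inverse of `g x` disappears, since `g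
x` is applied to the Christoffel vector. -/
theorem continuous_divergence {n : ℕ} {U : Set (E n)} (hU : IsOpen U) {g : BilinField n}
    (hg : IsMetricOn U g) {X : E n → E n} (hX : ContDiff ℝ 1 X) :
    Continuous fun p : U × Gr n => divergence g X p.1 p.2 := by
  have hform : ∀ p : U × Gr n, divergence g X p.1 p.2 = ∑ k, covForm g X p.1
      (planeInverse (g p.1) p.2.1.starProjection (EuclideanSpace.basisFun (Fin (n + 1)) ℝ k))
      (EuclideanSpace.basisFun (Fin (n + 1)) ℝ k) := by
    intro p
    obtain ⟨e, he⟩ := exists_isONBasis (g p.1) (hg.symm _ p.1.2) (hg.pos _ p.1.2) p.2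
    rw [divergence_eq_sum_covForm hg X p.1.2 p.2 he,
      sum_planeInverse (hg.symm _ p.1.2) (hg.pos _ p.1.2) he]
  simp_rw [hform, covForm_apply, christoffelFirst, _root_.smul_apply, _root_.sub_apply,
    _root_.add_apply, ContinuousLinearMap.flip_apply]
  have hval : Continuous fun p : U × Gr n => (p.1 : E n) :=
    continuous_subtype_val.comp continuous_fst
  have h1 : Continuous fun p : U × Gr n => g p.1 :=
    (continuousOn_iff_continuous_domRestrict.mp hg.contDiffOn.continuousOn).comp continuous_fst
  have h2 : Continuous fun p : U × Gr n => fderiv ℝ g p.1 :=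
    (continuousOn_iff_continuous_domRestrict.mp
      (hg.contDiffOn.continuousOn_fderiv_of_isOpen hU le_rfl)).comp continuous_fst
  have h3 : Continuous fun p : U × Gr n => planeInverse (g p.1) p.2.1.starProjection :=
    continuous_planeInverse h1 (fun p => hg.pos _ p.1.2) continuous_snd
  have h4 : Continuous fun p : U × Gr n => fderiv ℝ X p.1 :=
    (hX.continuous_fderiv one_ne_zero).comp hval
  have h5 : Continuous fun p : U × Gr n => X p.1 := hX.continuous.comp hval
  refine continuous_finsetSum _ fun k _ => ?_
  have h6 := h3.clm_apply (continuous_const (y := EuclideanSpace.basisFun (Fin (n + 1)) ℝ k))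
  have h7 := h2.clm_apply h6
  have h8 := h2.clm_apply
    (continuous_const (y := EuclideanSpace.basisFun (Fin (n + 1)) ℝ k))
  have a1 := (h1.clm_apply (h4.clm_apply h6)).clm_apply
    (continuous_const (y := EuclideanSpace.basisFun (Fin (n + 1)) ℝ k))
  have a2 := (h7.clm_apply h5).clm_apply
    (continuous_const (y := EuclideanSpace.basisFun (Fin (n + 1)) ℝ k))
  have a3 := ((h2.clm_apply h5).clm_apply h6).clm_apply
    (continuous_const (y := EuclideanSpace.basisFun (Fin (n + 1)) ℝ k))
  have a4 := (h8.clm_apply h6).clm_apply h5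
  exact a1.add (((a2.add a3).sub a4).const_smul (1 / 2 : ℝ))

/-- A continuous function on `U × G(n, n+1)` that vanishes over the complement of a compact subset of
`U` is integrable. -/
theorem Varifold.integrable_of_continuous {n : ℕ} {U : Set (E n)} (V : Varifold n U)
    {f : U × Gr n → ℝ} (hf : Continuous f) {K : Set (E n)} (hK : IsCompact K) (hKU : K ⊆ U)
    (h0 : ∀ p : U × Gr n, (p.1 : E n) ∉ K → f p = 0) : Integrable f V.measure := by
  have := V.locallyFinite
  have hK' : IsCompact ((Subtype.val ⁻¹' K : Set U) ×ˢ (univ : Set (Gr n))) := by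
    refine IsCompact.prod ?_ isCompact_univ
    refine IsInducing.subtypeVal.isCompact_preimage' hK ?_
    simpa using hKU
  refine hf.integrable_of_hasCompactSupport ?_
  exact HasCompactSupport.intro' hK'
    ((hK.isClosed.preimage continuous_subtype_val).prod isClosed_univ)
    fun p hp => h0 p fun h => hp ⟨h, trivial⟩

/-! ### Comparison of the metric with the Euclidean and the frozen metric -/

theorem C1CloseToEuclid.abs_sub_le {n : ℕ} {U : Set (E n)} {g : BilinField n} {η : ℝ}
    (hc : C1CloseToEuclid U g η) {x : E n} (hx : x ∈ U) (v : E n) :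
    |g x v v - ‖v‖ ^ 2| ≤ η * ‖v‖ ^ 2 := by
  have h := (g x - euclid n).le_opNorm₂ v v
  rw [_root_.sub_apply, _root_.sub_apply, euclid_apply, real_inner_self_eq_norm_sq,
    Real.norm_eq_abs, mul_assoc, ← sq] at h
  exact h.trans (by gcongr; exact (hc x hx).1)

/-- Mean value inequality on a convex set. The factor `‖x - ξ‖` is what keeps the relative error of
the radial term linear in the radius. -/
theorem C1CloseToEuclid.abs_sub_le_dist {n : ℕ} {U : Set (E n)} (hU : IsOpen U)
    (hconv : Convex ℝ U) {g : BilinField n} (hg : IsMetricOn U g) {η : ℝ}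
    (hc : C1CloseToEuclid U g η) {x ξ : E n} (hx : x ∈ U) (hξ : ξ ∈ U) (v : E n) :
    |g x v v - g ξ v v| ≤ η * ‖x - ξ‖ * ‖v‖ ^ 2 := by
  have h1 : ‖g x - g ξ‖ ≤ η * ‖x - ξ‖ :=
    hconv.norm_image_sub_le_of_norm_fderiv_le (𝕜 := ℝ)
      (fun z hz => (hg.contDiffOn.contDiffAt (hU.mem_nhds hz)).differentiableAt one_ne_zero)
      (fun z hz => (hc z hz).2) hξ hx
  have h := (g x - g ξ).le_opNorm₂ v v
  rw [_root_.sub_apply, _root_.sub_apply, Real.norm_eq_abs, mul_assoc, ← sq] at h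
  exact h.trans (by gcongr)

theorem abs_christoffelFirst_le {n : ℕ} {g : BilinField n} {η : ℝ} {x : E n}
    (hx : ‖fderiv ℝ g x‖ ≤ η) (v w z : E n) :
    |christoffelFirst g x v w z| ≤ 3 / 2 * η * (‖v‖ * ‖w‖ * ‖z‖) := by
  have key : ∀ a b c : E n, |fderiv ℝ g x a b c| ≤ η * (‖a‖ * ‖b‖ * ‖c‖) := by
    intro a b c
    calc |fderiv ℝ g x a b c| ≤ ‖fderiv ℝ g x a‖ * ‖b‖ * ‖c‖ := (fderiv ℝ g x a).le_opNorm₂ b c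
      _ ≤ (‖fderiv ℝ g x‖ * ‖a‖) * ‖b‖ * ‖c‖ := by
        gcongr; exact (fderiv ℝ g x).le_opNorm a
      _ ≤ (η * ‖a‖) * ‖b‖ * ‖c‖ := by gcongr
      _ = η * (‖a‖ * ‖b‖ * ‖c‖) := by ring
  have h1 := abs_le.mp (key v w z)
  have h2 := abs_le.mp (key w v z)
  have h3 := abs_le.mp (key z v w)
  simp only [christoffelFirst, _root_.smul_apply, _root_.sub_apply, _root_.add_apply,
    ContinuousLinearMap.flip_apply, smul_eq_mul]
  have e2 : ‖w‖ * ‖v‖ * ‖z‖ = ‖v‖ * ‖w‖ * ‖z‖ := by ring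
  have e3 : ‖z‖ * ‖v‖ * ‖w‖ = ‖v‖ * ‖w‖ * ‖z‖ := by ring
  rw [e2] at h2
  rw [e3] at h3
  rw [abs_le]
  constructor <;> linarith [h1.1, h1.2, h2.1, h2.2, h3.1, h3.2]

/-! ### The test field and the pointwise inequality -/

/-- The divergence of a multiple of the position vector field about `ξ`.  Here `T` is the
`g`-orthogonal projection of `x - ξ` to `S`. -/
theorem exists_divergence_smul_eq {n : ℕ} {U : Set (E n)} {g : BilinField n} (hg : IsMetricOn U g)
    {η : ℝ} (hη : η < 1) (hc : C1CloseToEuclid U g η) {f : E n → ℝ} (ξ : E n) {x : E n}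
    (hf : DifferentiableAt ℝ f x) (hx : x ∈ U) (S : Gr n) :
    ∃ T ∈ S.1, ∃ Γ : ℝ, g x T T = g x (x - ξ) T ∧ |Γ| ≤ 3 / 2 * n * (η / (1 - η)) * ‖x - ξ‖ ∧
      divergence g (fun z => f z • (z - ξ)) x S = fderiv ℝ f x T + n * f x + f x * Γ := by
  obtain ⟨e, he⟩ := exists_isONBasis (g x) (hg.symm _ hx) (hg.pos _ hx) S
  have hη' : 0 < 1 - η := by linarith
  refine ⟨∑ i, g x (x - ξ) (e i) • e i, Submodule.sum_mem _ fun i _ => S.1.smul_mem _ (he.mem i),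
    ∑ i, christoffelFirst g x (e i) (x - ξ) (e i), ?_, ?_, ?_⟩
  · have h1 : ∀ i, g x (∑ j, g x (x - ξ) (e j) • e j) (e i) = g x (x - ξ) (e i) := fun i => by
      simp [he.2]
    conv_lhs => rw [map_sum]
    conv_rhs => rw [map_sum]
    exact Finset.sum_congr rfl fun i _ => by rw [map_smul, h1, map_smul]
  · refine (Finset.abs_sum_le_sum_abs _ _).trans ?_
    have h2 : ∀ i ∈ Finset.univ, |christoffelFirst g x (e i) (x - ξ) (e i)|
        ≤ 3 / 2 * (η / (1 - η)) * ‖x - ξ‖ := by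
      intro i _
      have h3 := abs_le.mp (hc.abs_sub_le hx (e i))
      rw [he.2, if_pos rfl] at h3
      -- A `g x`-unit vector has bounded Euclidean length; this produces the quotient `η / (1 - η)`.
      have h4 : ‖e i‖ ^ 2 ≤ 1 / (1 - η) := by
        rw [le_div_iff₀ hη']
        linarith [h3.1]
      have hη0 : 0 ≤ η := (norm_nonneg _).trans (hc x hx).1
      calc |christoffelFirst g x (e i) (x - ξ) (e i)|
          ≤ 3 / 2 * η * (‖e i‖ * ‖x - ξ‖ * ‖e i‖) := abs_christoffelFirst_le (hc x hx).2 _ _ _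
        _ = 3 / 2 * η * ‖x - ξ‖ * ‖e i‖ ^ 2 := by ring
        _ ≤ 3 / 2 * η * ‖x - ξ‖ * (1 / (1 - η)) := by gcongr
        _ = _ := by ring
    refine (Finset.sum_le_card_nsmul _ _ _ h2).trans (le_of_eq ?_)
    simp
    ring
  · rw [divergence_eq_sum_covForm hg _ hx S he]
    have hder : ∀ v, fderiv ℝ (fun z => f z • (z - ξ)) x v = f x • v + fderiv ℝ f x v • (x - ξ) := by
      intro v
      rw [fderiv_fun_smul hf (by fun_prop)]
      simp [fderiv_sub_const]
    have hchr : ∀ v, christoffelFirst g x v (f x • (x - ξ)) v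
        = f x * christoffelFirst g x v (x - ξ) v := by
      intro v
      simp only [christoffelFirst, map_smul, _root_.smul_apply, _root_.sub_apply,
        _root_.add_apply, ContinuousLinearMap.flip_apply, smul_eq_mul]
      ring
    have hterm : ∀ i, covForm g (fun z => f z • (z - ξ)) x (e i) (e i)
        = g x (x - ξ) (e i) * fderiv ℝ f x (e i) + f x
          + f x * christoffelFirst g x (e i) (x - ξ) (e i) := by
      intro i
      rw [covForm_apply, hder, hchr, map_add, map_smul, map_smul, _root_.add_apply,
        _root_.smul_apply, _root_.smul_apply, he.2, if_pos rfl]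
      simp only [smul_eq_mul]
      ring
    simp only [hterm, Finset.sum_add_distrib, map_sum, map_smul, smul_eq_mul, Finset.mul_sum]
    simp

/-- A smooth nonincreasing profile with values in `[0, 1]` that vanishes from `1` on. -/
structure IsProfile (φ : ℝ → ℝ) : Prop where
  contDiff : ContDiff ℝ 1 φ
  antitone : Antitone φ
  nonneg : ∀ u, 0 ≤ φ u
  le_one : ∀ u, φ u ≤ 1
  eq_zero : ∀ u, 1 ≤ u → φ u = 0

/-- Each such `u`, including the endpoint `1`, is a minimum of `φ`. -/
theorem IsProfile.deriv_eq_zero {φ : ℝ → ℝ} (hφ : IsProfile φ) {u : ℝ} (hu : 1 ≤ u) :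
    deriv φ u = 0 :=
  IsLocalMin.deriv_eq_zero (Eventually.of_forall fun v => by
    rw [hφ.eq_zero u hu]; exact hφ.nonneg v)

theorem exists_isProfile {θ : ℝ} (hθ : θ < 1) : ∃ φ, IsProfile φ ∧ ∀ u ≤ θ, φ u = 1 := by
  have h0 : 0 < 1 - θ := by linarith
  refine ⟨fun u => Real.smoothTransition ((1 - u) / (1 - θ)), ⟨?_, ?_, fun _ =>
    Real.smoothTransition.nonneg _, fun _ => Real.smoothTransition.le_one _, ?_⟩, ?_⟩
  · exact Real.smoothTransition.contDiff.comp (by fun_prop)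
  · intro u v huv
    apply Real.smoothTransition.monotone
    gcongr
  · intro u hu
    exact Real.smoothTransition.zero_of_nonpos (div_nonpos_of_nonpos_of_nonneg (by linarith) h0.le)
  · intro u hu
    apply Real.smoothTransition.one_of_one_le
    rw [le_div_iff₀ h0]
    linarith

/-- The squared distance from `ξ` for the constant metric `g ξ`, scaled so that it dominates the
squared Euclidean distance. -/
def radialSq {n : ℕ} (g : BilinField n) (η : ℝ) (ξ x : E n) : ℝ :=
  g ξ (x - ξ) (x - ξ) / (1 - η)

theorem contDiff_radialSq {n : ℕ} (g : BilinField n) (η : ℝ) (ξ : E n) :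
    ContDiff ℝ 1 (radialSq g η ξ) := by
  unfold radialSq
  have h : ContDiff ℝ 1 fun x : E n => g ξ (x - ξ) :=
    (g ξ).contDiff.comp (contDiff_id.sub contDiff_const)
  exact (h.clm_apply (contDiff_id.sub contDiff_const)).div_const _

theorem fderiv_radialSq {n : ℕ} {g : BilinField n} (η : ℝ) {ξ : E n}
    (hs : ∀ v w, g ξ v w = g ξ w v) (x v : E n) :
    fderiv ℝ (radialSq g η ξ) x v = 2 * g ξ (x - ξ) v / (1 - η) := by
  have h1 : HasFDerivAt (fun z : E n => z - ξ) (ContinuousLinearMap.id ℝ (E n)) x :=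
    (hasFDerivAt_id x).sub_const ξ
  have h2 : HasFDerivAt (fun z : E n => g ξ (z - ξ))
      ((g ξ).comp (ContinuousLinearMap.id ℝ (E n))) x :=
    (g ξ).hasFDerivAt.comp x h1
  have h3 := (h2.clm_apply h1).mul_const (1 - η)⁻¹
  have h4 : radialSq g η ξ = fun z => g ξ (z - ξ) (z - ξ) * (1 - η)⁻¹ := by
    ext z; rw [radialSq, div_eq_mul_inv]
  rw [h4, h3.fderiv]
  simp [hs v x, hs v ξ]
  ring

/-- The scaling by `1 - η` serves this bound: `φ (radialSq g η ξ x / t ^ 2)` then vanishes outside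
the Euclidean `ball ξ t`. -/
theorem sq_norm_le_radialSq {n : ℕ} {U : Set (E n)} {g : BilinField n} {η : ℝ} (hη : η < 1)
    (hc : C1CloseToEuclid U g η) {ξ : E n} (hξ : ξ ∈ U) (x : E n) :
    ‖x - ξ‖ ^ 2 ≤ radialSq g η ξ x := by
  rw [radialSq, le_div_iff₀ (by linarith)]
  linarith [(abs_le.mp (hc.abs_sub_le hξ (x - ξ))).1]

theorem radialSq_le {n : ℕ} {U : Set (E n)} {g : BilinField n} {η : ℝ} (hη : η < 1)
    (hc : C1CloseToEuclid U g η) {ξ : E n} (hξ : ξ ∈ U) (x : E n) :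
    radialSq g η ξ x ≤ (1 + η) / (1 - η) * ‖x - ξ‖ ^ 2 := by
  rw [radialSq, div_mul_eq_mul_div, div_le_div_iff_of_pos_right (by linarith)]
  linarith [(abs_le.mp (hc.abs_sub_le hξ (x - ξ))).2]

/-- The weight `h` localized to the ellipsoid of size `t` about `ξ`. -/
def localized {n : ℕ} (g : BilinField n) (η : ℝ) (ξ : E n) (φ : ℝ → ℝ) (h : E n → ℝ) (t : ℝ)
    (x : E n) : ℝ :=
  h x * φ (radialSq g η ξ x / t ^ 2)

theorem contDiff_localized {n : ℕ} (g : BilinField n) (η : ℝ) (ξ : E n) {φ : ℝ → ℝ}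
    (hφ : IsProfile φ) {h : E n → ℝ} (hh : ContDiff ℝ 1 h) (t : ℝ) :
    ContDiff ℝ 1 (localized g η ξ φ h t) :=
  hh.mul (hφ.contDiff.comp ((contDiff_radialSq g η ξ).div_const _))

theorem fderiv_localized {n : ℕ} {g : BilinField n} (η : ℝ) {ξ : E n}
    (hs : ∀ v w, g ξ v w = g ξ w v) {φ : ℝ → ℝ} (hφ : IsProfile φ) {h : E n → ℝ}
    (hh : ContDiff ℝ 1 h) (t : ℝ) (x v : E n) :
    fderiv ℝ (localized g η ξ φ h t) x v
      = φ (radialSq g η ξ x / t ^ 2) * fderiv ℝ h x v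
        + h x * (deriv φ (radialSq g η ξ x / t ^ 2) * (2 * g ξ (x - ξ) v / (1 - η) / t ^ 2)) := by
  have h1 : HasFDerivAt (radialSq g η ξ) (fderiv ℝ (radialSq g η ξ) x) x :=
    ((contDiff_radialSq g η ξ).differentiable one_ne_zero x).hasFDerivAt
  have h2 := h1.mul_const (t ^ 2)⁻¹
  have h3 : HasDerivAt φ (deriv φ (radialSq g η ξ x * (t ^ 2)⁻¹)) (radialSq g η ξ x * (t ^ 2)⁻¹) :=
    (hφ.contDiff.differentiable one_ne_zero _).hasDerivAt
  have h4 := h3.comp_hasFDerivAt x h2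
  have h5 : HasFDerivAt h (fderiv ℝ h x) x := (hh.differentiable one_ne_zero x).hasFDerivAt
  have h6 := h5.mul h4
  have h7 : localized g η ξ φ h t
      = fun z => h z * (φ ∘ fun y => radialSq g η ξ y * (t ^ 2)⁻¹) z := by
    ext z; simp [localized, div_eq_mul_inv]
  rw [h7]
  refine (congrArg (fun A : E n →L[ℝ] ℝ => A v) h6.fderiv).trans ?_
  simp [fderiv_radialSq η hs, div_eq_mul_inv]
  ring

/-- The constant metric at `ξ` and the metric at `x` are close enough for the mixed term of the
first variation to be of the expected size. -/
theorem radial_apply_tangential_le {n : ℕ} {U : Set (E n)} (hU : IsOpen U) (hconv : Convex ℝ U)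
    {g : BilinField n} (hg : IsMetricOn U g) {η : ℝ} (hη0 : 0 < η) (hη : η < 1)
    (hc : C1CloseToEuclid U g η) {x ξ : E n} (hx : x ∈ U) (hξ : ξ ∈ U) (hr : ‖x - ξ‖ ≤ 1) {T : E n}
    (hT : g x T T = g x (x - ξ) T) :
    g ξ (x - ξ) T ≤ (1 + (η / (1 - η) + (η / (1 - η)) ^ 2) * ‖x - ξ‖) * g ξ (x - ξ) (x - ξ) ∧
      ‖T‖ ≤ (1 + 2 * η) / (1 - η) * ‖x - ξ‖ := by
  have hη' : 0 < 1 - η := by linarith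
  set y := x - ξ with hy
  set κ := η / (1 - η) with hκ
  have hκ0 : 0 < κ := div_pos hη0 hη'
  have hκη : κ * (1 - η) = η := div_mul_cancel₀ _ hη'.ne'
  have nn : ∀ z ∈ U, ∀ v, 0 ≤ g z v v := by
    intro z hz v
    by_cases hv : v = 0
    · simp [hv]
    · exact (hg.pos z hz v hv).le
  -- Projections do not increase length: by `hT`, `g x (y - T) (y - T) = g x y y - g x T T`.
  have h1 : g x T T ≤ g x y y := by
    have h := nn x hx (y - T)
    simp only [map_sub, _root_.sub_apply] at h
    rw [hg.symm x hx T y] at h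
    linarith
  have lowx : ∀ v, (1 - η) * ‖v‖ ^ 2 ≤ g x v v := fun v => by
    linarith [(abs_le.mp (hc.abs_sub_le hx v)).1]
  have lowξ : ∀ v, (1 - η) * ‖v‖ ^ 2 ≤ g ξ v v := fun v => by
    linarith [(abs_le.mp (hc.abs_sub_le hξ v)).1]
  have cmp1 : ∀ v, g ξ v v ≤ (1 + κ * ‖y‖) * g x v v := fun v => by
    have h2 := (abs_le.mp (hc.abs_sub_le_dist hU hconv hg hx hξ v)).1
    have h3 := mul_le_mul_of_nonneg_left (lowx v) (mul_nonneg hκ0.le (norm_nonneg y))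
    have h4 : κ * ‖y‖ * ((1 - η) * ‖v‖ ^ 2) = η * ‖y‖ * ‖v‖ ^ 2 := by
      linear_combination ‖y‖ * ‖v‖ ^ 2 * hκη
    linarith
  have cmp2 : ∀ v, g x v v ≤ (1 + κ * ‖y‖) * g ξ v v := fun v => by
    have h2 := (abs_le.mp (hc.abs_sub_le_dist hU hconv hg hx hξ v)).2
    have h3 := mul_le_mul_of_nonneg_left (lowξ v) (mul_nonneg hκ0.le (norm_nonneg y))
    have h4 : κ * ‖y‖ * ((1 - η) * ‖v‖ ^ 2) = η * ‖y‖ * ‖v‖ ^ 2 := by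
      linear_combination ‖y‖ * ‖v‖ ^ 2 * hκη
    linarith
  constructor
  -- Use `2 g ξ y T ≤ g ξ y y + g ξ T T` and bound the last term by passing from `ξ` to `x`,
  -- projecting, and passing back. The two passages give `(1 + κ ‖y‖)²`, whose quadratic part is
  -- linearized by `‖y‖ ≤ 1`.
  · have h := nn ξ hξ (y - T)
    simp only [map_sub, _root_.sub_apply] at h
    rw [hg.symm ξ hξ T y] at h
    have h2 : g ξ T T ≤ (1 + κ * ‖y‖) * ((1 + κ * ‖y‖) * g ξ y y) :=
      (cmp1 T).trans (mul_le_mul_of_nonneg_left (h1.trans (cmp2 y)) (by positivity))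
    have h3 : κ ^ 2 * ‖y‖ ^ 2 * g ξ y y ≤ κ ^ 2 * ‖y‖ * g ξ y y := by
      have := nn ξ hξ y
      gcongr
      nlinarith [norm_nonneg y]
    have h4 : 0 ≤ κ ^ 2 * ‖y‖ * g ξ y y := mul_nonneg (by positivity) (nn ξ hξ y)
    linarith
  · have hL : 1 ≤ (1 + 2 * η) / (1 - η) := by rw [le_div_iff₀ hη']; linarith
    have h2 : (1 - η) * ‖T‖ ^ 2 ≤ (1 + η) * ‖y‖ ^ 2 := by
      linarith [lowx T, (abs_le.mp (hc.abs_sub_le hx y)).2]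
    have h3 : ‖T‖ ^ 2 ≤ (1 + 2 * η) / (1 - η) * ‖y‖ ^ 2 := by
      rw [div_mul_eq_mul_div, le_div_iff₀ hη']
      nlinarith [sq_nonneg ‖y‖]
    refine abs_le_of_sq_le_sq' ?_ (by positivity) |>.2
    calc ‖T‖ ^ 2 ≤ (1 + 2 * η) / (1 - η) * ‖y‖ ^ 2 := h3
      _ ≤ ((1 + 2 * η) / (1 - η)) * ((1 + 2 * η) / (1 - η)) * ‖y‖ ^ 2 := by
        gcongr
        exact le_mul_of_one_le_left (by positivity) hL
      _ = _ := by ring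

theorem neg_le_fderiv_of_mem {n : ℕ} (h : E n → ℝ) (x : E n) (S : Gr n) {T : E n} (hT : T ∈ S.1) :
    -(tangentialGradNorm h x S * ‖T‖) ≤ fderiv ℝ h x T := by
  have h1 : fderiv ℝ h x T = inner ℝ (S.1.starProjection (gradient h x)) T := by
    rw [S.1.inner_starProjection_left_eq_right, Submodule.starProjection_eq_self_iff.mpr hT,
      gradient, InnerProductSpace.toDual_symm_apply]
  rw [h1]
  exact (abs_le.mp (abs_real_inner_le_norm _ _)).1

/-- The pointwise form of the monotonicity inequality. -/
theorem mul_localized_le {n : ℕ} {U : Set (E n)} (hU : IsOpen U) (hconv : Convex ℝ U)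
    {g : BilinField n} (hg : IsMetricOn U g) {η : ℝ} (hη0 : 0 < η) (hη : η < 1)
    (hc : C1CloseToEuclid U g η) {φ : ℝ → ℝ} (hφ : IsProfile φ) {h : E n → ℝ}
    (hh : ContDiff ℝ 1 h) (h0 : ∀ x, 0 ≤ h x) {ξ : E n} (hξ : ξ ∈ U) {t : ℝ} (ht0 : 0 < t)
    (ht : t ≤ 1) {x : E n} (hx : x ∈ U) (S : Gr n) :
    n * localized g η ξ φ h t x
      ≤ divergence g (fun z => localized g η ξ φ h t z • (z - ξ)) x S
        + (1 + (η / (1 - η) + (η / (1 - η)) ^ 2) * t) * t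
          * (h x * (deriv φ (radialSq g η ξ x / t ^ 2) * (-2 * radialSq g η ξ x / t ^ 3)))
        + (1 + 2 * η) / (1 - η) * t * (ball ξ t).indicator (fun z => tangentialGradNorm h z S) x
        + 3 / 2 * n * (η / (1 - η)) * t * localized g η ξ φ h t x := by
  have hη' : 0 < 1 - η := by linarith
  obtain ⟨T, hTS, Γ, hT, hΓ, hdiv⟩ := exists_divergence_smul_eq hg hη hc (f := localized g η ξ φ h t)
    ξ ((contDiff_localized g η ξ hφ hh t).differentiable one_ne_zero x) hx S
  rw [hdiv, fderiv_localized η (hg.symm ξ hξ) hφ hh]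
  by_cases hxt : ‖x - ξ‖ < t
  · have hball : x ∈ ball ξ t := by rwa [mem_ball, dist_eq_norm]
    rw [indicator_of_mem hball]
    obtain ⟨hA, hTn⟩ := radial_apply_tangential_le hU hconv hg hη0 hη hc hx hξ (hxt.le.trans ht) hT
    set κ := η / (1 - η) with hκ
    have hκ0 : 0 < κ := div_pos hη0 hη'
    set u := radialSq g η ξ x / t ^ 2 with hu
    set L := (1 + 2 * η) / (1 - η) with hL
    have hL0 : 0 < L := div_pos (by linarith) hη'
    have hf0 : 0 ≤ localized g η ξ φ h t x := mul_nonneg (h0 x) (hφ.nonneg _)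
    have hA0 : 0 ≤ g ξ (x - ξ) (x - ξ) := by
      nlinarith [(abs_le.mp (hc.abs_sub_le hξ (x - ξ))).1, sq_nonneg ‖x - ξ‖]
    have i1 : -(3 / 2 * n * κ * t * localized g η ξ φ h t x) ≤ localized g η ξ φ h t x * Γ := by
      have h1 : -(3 / 2 * n * κ * t) ≤ Γ := by
        have h2 : 3 / 2 * n * κ * ‖x - ξ‖ ≤ 3 / 2 * n * κ * t := by gcongr
        linarith [(abs_le.mp hΓ).1]
      linarith [mul_le_mul_of_nonneg_left h1 hf0]
    have i2 : -(L * t * tangentialGradNorm h x S) ≤ φ u * fderiv ℝ h x T := by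
      have hG : 0 ≤ tangentialGradNorm h x S := norm_nonneg _
      have h1 : tangentialGradNorm h x S * ‖T‖ ≤ L * t * tangentialGradNorm h x S := by
        rw [mul_comm]
        gcongr
        exact hTn.trans (by gcongr)
      have h2 : -(L * t * tangentialGradNorm h x S) ≤ fderiv ℝ h x T :=
        (neg_le_neg h1).trans (neg_le_fderiv_of_mem h x S hTS)
      have h3 : 0 ≤ L * t * tangentialGradNorm h x S := by positivity
      have h4 := mul_le_mul_of_nonneg_left h2 (hφ.nonneg u)
      have h5 := mul_le_mul_of_nonneg_right (hφ.le_one u) h3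
      linarith
    -- The derivative of `φ` is nonpositive, so the upper bound on `g ξ (x - ξ) T` is a lower bound
    -- on the radial part of the divergence; with `g ξ (x - ξ) (x - ξ)` in its place that part is
    -- `-t` times the derivative of the cut-off weight in `t`.
    have i3 : 0 ≤ h x * (deriv φ u * (2 * g ξ (x - ξ) T / (1 - η) / t ^ 2))
        + (1 + (κ + κ ^ 2) * t) * t * (h x * (deriv φ u * (-2 * radialSq g η ξ x / t ^ 3))) := by
      have h1 : g ξ (x - ξ) T ≤ (1 + (κ + κ ^ 2) * t) * g ξ (x - ξ) (x - ξ) :=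
        hA.trans (by gcongr)
      have h2 : 0 ≤ 2 * h x * -deriv φ u / ((1 - η) * t ^ 2) := by
        have := hφ.antitone.deriv_nonpos (x := u)
        have := h0 x
        apply div_nonneg _ (by positivity)
        apply mul_nonneg <;> linarith
      have h3 := mul_nonneg h2 (sub_nonneg.mpr h1)
      refine h3.trans (le_of_eq ?_)
      rw [radialSq]
      field_simp
      ring
    linarith
  · have h1 : 1 ≤ radialSq g η ξ x / t ^ 2 := by
      rw [le_div_iff₀ (by positivity), one_mul]
      refine le_trans ?_ (sq_norm_le_radialSq hη hc hξ x)
      have := not_lt.mp hxt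
      gcongr
    have hball : x ∉ ball ξ t := by rwa [mem_ball, dist_eq_norm]
    simp [hφ.eq_zero _ h1, hφ.deriv_eq_zero h1, indicator_of_notMem hball, localized]

/-! ### Integration over the varifold -/

theorem measurable_base (n : ℕ) (U : Set (E n)) :
    Measurable fun p : U × Gr n => (p.1 : E n) :=
  measurable_subtype_coe.comp measurable_fst

theorem continuous_base (n : ℕ) (U : Set (E n)) :
    Continuous fun p : U × Gr n => (p.1 : E n) :=
  continuous_subtype_val.comp continuous_fst

theorem Varifold.integrable_base {n : ℕ} {U : Set (E n)} (V : Varifold n U) {f : E n → ℝ}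
    (hf : Continuous f) (hc : HasCompactSupport f) (hU : tsupport f ⊆ U) :
    Integrable (fun p : U × Gr n => f p.1) V.measure :=
  V.integrable_of_continuous (hf.comp (continuous_base n U)) hc hU
    fun _ hp => image_eq_zero_of_notMem_tsupport hp

/-- The integral of the localized weight. -/
def Varifold.localMass {n : ℕ} {U : Set (E n)} (V : Varifold n U) (g : BilinField n) (η : ℝ)
    (ξ : E n) (φ : ℝ → ℝ) (h : E n → ℝ) (t : ℝ) : ℝ :=
  ∫ p, localized g η ξ φ h t p.1 ∂V.measure

/-- The derivative of `localMass` in the size `t`. -/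
def Varifold.localMassDeriv {n : ℕ} {U : Set (E n)} (V : Varifold n U) (g : BilinField n) (η : ℝ)
    (ξ : E n) (φ : ℝ → ℝ) (h : E n → ℝ) (t : ℝ) : ℝ :=
  ∫ p : U × Gr n, h p.1 * (deriv φ (radialSq g η ξ p.1 / t ^ 2)
    * (-2 * radialSq g η ξ p.1 / t ^ 3)) ∂V.measure

/-- The integral of the tangential gradient over the ball of radius `t`. -/
def Varifold.ballGrad {n : ℕ} {U : Set (E n)} (V : Varifold n U) (ξ : E n) (h : E n → ℝ)
    (t : ℝ) : ℝ :=
  ∫ p : U × Gr n, (ball ξ t).indicator (fun z => tangentialGradNorm h z p.2) p.1 ∂V.measure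

theorem tsupport_localized_subset {n : ℕ} (g : BilinField n) (η : ℝ) (ξ : E n) (φ : ℝ → ℝ)
    (h : E n → ℝ) (t : ℝ) : tsupport (localized g η ξ φ h t) ⊆ tsupport h :=
  tsupport_mul_subset_left

theorem Varifold.integrable_localized {n : ℕ} {U : Set (E n)} (V : Varifold n U) (g : BilinField n)
    (η : ℝ) (ξ : E n) {φ : ℝ → ℝ} (hφ : IsProfile φ) {h : E n → ℝ} (hh : ContDiff ℝ 1 h)
    (hc : HasCompactSupport h) (hU : tsupport h ⊆ U) (t : ℝ) :
    Integrable (fun p : U × Gr n => localized g η ξ φ h t p.1) V.measure :=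
  V.integrable_base (contDiff_localized g η ξ hφ hh t).continuous (hc.mul_right)
    ((tsupport_localized_subset g η ξ φ h t).trans hU)

theorem continuous_tangentialGradNorm {n : ℕ} {U : Set (E n)} {h : E n → ℝ}
    (hh : ContDiff ℝ 1 h) :
    Continuous fun p : U × Gr n => tangentialGradNorm h p.1 p.2 := by
  have h1 : Continuous fun p : U × Gr n => gradient h p.1 :=
    (InnerProductSpace.toDual ℝ (E n)).symm.continuous.comp
      ((hh.continuous_fderiv one_ne_zero).comp (continuous_base n U))
  exact (((continuous_starProjection n).comp continuous_snd).clm_apply h1).norm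

theorem Varifold.integrable_tangentialGradNorm {n : ℕ} {U : Set (E n)} (V : Varifold n U)
    {h : E n → ℝ} (hh : ContDiff ℝ 1 h) (hc : HasCompactSupport h) (hU : tsupport h ⊆ U) :
    Integrable (fun p : U × Gr n => tangentialGradNorm h p.1 p.2) V.measure := by
  refine V.integrable_of_continuous (continuous_tangentialGradNorm hh) hc hU fun p hp => ?_
  simp [tangentialGradNorm, gradient, fderiv_of_notMem_tsupport ℝ hp]

theorem Varifold.integrable_ballGrad {n : ℕ} {U : Set (E n)} (V : Varifold n U) (ξ : E n)
    {h : E n → ℝ} (hh : ContDiff ℝ 1 h) (hc : HasCompactSupport h) (hU : tsupport h ⊆ U) (t : ℝ) :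
    Integrable (fun p : U × Gr n =>
      (ball ξ t).indicator (fun z => tangentialGradNorm h z p.2) p.1) V.measure :=
  (V.integrable_tangentialGradNorm hh hc hU).indicator
    (measurable_base n U measurableSet_ball : MeasurableSet {p : U × Gr n | (p.1 : E n) ∈ ball ξ t})

theorem Varifold.ballGrad_nonneg {n : ℕ} {U : Set (E n)} (V : Varifold n U) (ξ : E n)
    (h : E n → ℝ) (t : ℝ) : 0 ≤ V.ballGrad ξ h t :=
  integral_nonneg fun _ => indicator_nonneg (fun _ _ => norm_nonneg _) _

theorem Varifold.ballGrad_mono {n : ℕ} {U : Set (E n)} (V : Varifold n U) (ξ : E n)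
    {h : E n → ℝ} (hh : ContDiff ℝ 1 h) (hc : HasCompactSupport h) (hU : tsupport h ⊆ U) :
    Monotone (V.ballGrad ξ h) := fun s t hst =>
  integral_mono (V.integrable_ballGrad ξ hh hc hU s) (V.integrable_ballGrad ξ hh hc hU t)
    fun _ => indicator_le_indicator_of_subset (ball_subset_ball hst) (fun _ => norm_nonneg _) _

theorem Varifold.hasDerivAt_localMass {n : ℕ} {U : Set (E n)} (V : Varifold n U) {g : BilinField n}
    {η : ℝ} (hη : η < 1) (hcl : C1CloseToEuclid U g η) {ξ : E n} (hξ : ξ ∈ U) {φ : ℝ → ℝ}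
    (hφ : IsProfile φ) {h : E n → ℝ} (hh : ContDiff ℝ 1 h) (h0 : ∀ x, 0 ≤ h x)
    (hc : HasCompactSupport h) (hU : tsupport h ⊆ U) {t : ℝ} (ht : 0 < t) :
    Integrable (fun p : U × Gr n => h p.1 * (deriv φ (radialSq g η ξ p.1 / t ^ 2)
        * (-2 * radialSq g η ξ p.1 / t ^ 3))) V.measure ∧
      HasDerivAt (V.localMass g η ξ φ h) (V.localMassDeriv g η ξ φ h t) t := by
  have hφ' : Continuous (deriv φ) := hφ.contDiff.continuous_deriv le_rfl
  have hQ : Continuous (radialSq g η ξ) := (contDiff_radialSq g η ξ).continuous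
  obtain ⟨M, hM⟩ := (isCompact_Icc (a := (0 : ℝ)) (b := 1)).exists_bound_of_continuousOn
    hφ'.continuousOn
  have hM0 : 0 ≤ M := (norm_nonneg _).trans (hM 0 (by simp))
  -- The `t`-derivative of `φ(q / t²)` is `-φ'(u) u · 2 / t` with `u = q / t²`, so this bound
  -- dominates it uniformly in the point. The range `s > t / 2` then turns `2 / s` into at most `4 /
  -- t`.
  have hMu : ∀ u, 0 ≤ u → |deriv φ u| * u ≤ M := by
    intro u hu
    by_cases h1 : 1 ≤ u
    · simpa [hφ.deriv_eq_zero h1] using hM0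
    · have h2 := not_le.mp h1
      calc |deriv φ u| * u ≤ M * 1 := mul_le_mul (hM u ⟨hu, h2.le⟩) h2.le hu hM0
        _ = M := mul_one M
  refine hasDerivAt_integral_of_dominated_loc_of_deriv_le (s := Ioi (t / 2))
    (F := fun t (p : U × Gr n) => localized g η ξ φ h t p.1)
    (F' := fun t p => h p.1 * (deriv φ (radialSq g η ξ p.1 / t ^ 2)
        * (-2 * radialSq g η ξ p.1 / t ^ 3)))
    (bound := fun p => h p.1 * (4 * M / t))
    (Ioi_mem_nhds (by linarith))
    (Eventually.of_forall fun s =>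
      (V.integrable_localized g η ξ hφ hh hc hU s).aestronglyMeasurable)
    (V.integrable_localized g η ξ hφ hh hc hU t) ?_ ?_ ?_ ?_
  · refine Continuous.aestronglyMeasurable ?_
    have hc1 : Continuous fun x => h x * (deriv φ (radialSq g η ξ x / t ^ 2)
        * (-2 * radialSq g η ξ x / t ^ 3)) :=
      hh.continuous.mul ((hφ'.comp (hQ.div_const _)).mul ((continuous_const.mul hQ).div_const _))
    exact hc1.comp (continuous_base n U)
  · refine Eventually.of_forall fun p s hs => ?_
    have hs' : t / 2 < s := hs
    have hs0 : 0 < s := by linarith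
    have hQ0 : 0 ≤ radialSq g η ξ p.1 := (sq_nonneg _).trans (sq_norm_le_radialSq hη hcl hξ _)
    have h1 := hMu (radialSq g η ξ p.1 / s ^ 2) (by positivity)
    rw [norm_mul, Real.norm_of_nonneg (h0 _)]
    refine mul_le_mul_of_nonneg_left ?_ (h0 _)
    have h2 : ‖deriv φ (radialSq g η ξ p.1 / s ^ 2) * (-2 * radialSq g η ξ p.1 / s ^ 3)‖
        = |deriv φ (radialSq g η ξ p.1 / s ^ 2)| * (radialSq g η ξ p.1 / s ^ 2) * (2 / s) := by
      rw [norm_mul, Real.norm_eq_abs, neg_mul, neg_div, norm_neg, Real.norm_of_nonneg (by positivity)]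
      field_simp
    rw [h2]
    calc _ ≤ M * (2 / (t / 2)) := by gcongr
      _ = 4 * M / t := by field_simp; ring
  · exact (V.integrable_base hh.continuous hc hU).mul_const _
  · refine Eventually.of_forall fun p s hs => ?_
    have hs0 : 0 < s := lt_trans (by linarith) (mem_Ioi.mp hs)
    have h1 : HasDerivAt (fun s : ℝ => radialSq g η ξ p.1 / s ^ 2)
        (-2 * radialSq g η ξ p.1 / s ^ 3) s := by
      have h2 := (hasDerivAt_const s (radialSq g η ξ p.1)).div (hasDerivAt_pow 2 s)
        (by positivity)
      refine h2.congr_deriv ?_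
      field_simp
      ring
    have h2 : HasDerivAt φ (deriv φ (radialSq g η ξ p.1 / s ^ 2)) (radialSq g η ξ p.1 / s ^ 2) :=
      (hφ.contDiff.differentiable one_ne_zero _).hasDerivAt
    exact (h2.comp s h1).const_mul _

/-- Where the field is nonzero, `‖x - ξ‖ < t`, so its `g`-length is at most `√(1 + η) t` times the
weight. The root is coarsened to `1 + η`. -/
theorem Varifold.firstVariation_le {n : ℕ} {U : Set (E n)} (V : Varifold n U) {g : BilinField n}
    {η : ℝ} (hη0 : 0 < η) (hη : η < 1) (hcl : C1CloseToEuclid U g η) {b : ℝ} (hb : 0 ≤ b)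
    (hV : V.HasBoundedFirstVariation g b) {ξ : E n} (hξ : ξ ∈ U) {φ : ℝ → ℝ}
    (hφ : IsProfile φ) {h : E n → ℝ} (hh : ContDiff ℝ 1 h) (h0 : ∀ x, 0 ≤ h x)
    (hc : HasCompactSupport h) (hU : tsupport h ⊆ U) {t : ℝ} (ht : 0 < t) :
    V.firstVariation g (fun z => localized g η ξ φ h t z • (z - ξ))
      ≤ b * ((1 + η) * t * V.localMass g η ξ φ h t) := by
  have hf := contDiff_localized g η ξ hφ hh t
  have hf0 : ∀ x, 0 ≤ localized g η ξ φ h t x := fun x => mul_nonneg (h0 x) (hφ.nonneg _)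
  have hsub : tsupport (fun z => localized g η ξ φ h t z • (z - ξ)) ⊆ tsupport h :=
    (tsupport_smul_subset_left _ _).trans (tsupport_localized_subset g η ξ φ h t)
  have h1 := hV (fun z => localized g η ξ φ h t z • (z - ξ))
    (hf.smul (contDiff_id.sub contDiff_const)) (hc.of_isClosed_subset (isClosed_tsupport _) hsub)
    (hsub.trans hU)
  refine (le_abs_self _).trans (h1.trans (mul_le_mul_of_nonneg_left ?_ hb))
  have hm := (measurable_base n U).aemeasurable (μ := V.measure)
  have h2 : ∫ x, (1 + η) * t * localized g η ξ φ h t x ∂V.mass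
      = (1 + η) * t * V.localMass g η ξ φ h t := by
    rw [integral_const_mul, Varifold.mass, integral_map hm hf.continuous.aestronglyMeasurable,
      Varifold.localMass]
  rw [← h2]
  refine integral_mono_of_nonneg (Eventually.of_forall fun _ => Real.sqrt_nonneg _) ?_
    (Eventually.of_forall fun x => ?_)
  · refine Integrable.const_mul ?_ _
    rw [Varifold.mass, integrable_map_measure hf.continuous.aestronglyMeasurable hm]
    exact V.integrable_localized g η ξ hφ hh hc hU t
  · simp only [map_smul, _root_.smul_apply, smul_eq_mul]
    by_cases hx : x ∈ U ∧ ‖x - ξ‖ < t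
    · obtain ⟨hxU, hxt⟩ := hx
      apply Real.sqrt_le_iff.mpr
      refine ⟨mul_nonneg (by positivity) (hf0 x), ?_⟩
      have h3 : g x (x - ξ) (x - ξ) ≤ ((1 + η) * t) ^ 2 := by
        have h4 := (abs_le.mp (hcl.abs_sub_le hxU (x - ξ))).2
        calc g x (x - ξ) (x - ξ) ≤ (1 + η) * ‖x - ξ‖ ^ 2 := by linarith
          _ ≤ (1 + η) * t ^ 2 := by gcongr
          _ ≤ (1 + η) * (1 + η) * t ^ 2 := by
            gcongr
            exact le_mul_of_one_le_left (by positivity) (by linarith)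
          _ = _ := by ring
      calc _ = localized g η ξ φ h t x ^ 2 * g x (x - ξ) (x - ξ) := by ring
        _ ≤ localized g η ξ φ h t x ^ 2 * ((1 + η) * t) ^ 2 := by gcongr
        _ = _ := by ring
    · have h3 : localized g η ξ φ h t x = 0 := by
        rcases not_and_or.mp hx with hx | hx
        · rw [localized, image_eq_zero_of_notMem_tsupport fun hx' => hx (hU hx'), zero_mul]
        · rw [localized, hφ.eq_zero, mul_zero]
          rw [le_div_iff₀ (by positivity), one_mul]
          refine le_trans ?_ (sq_norm_le_radialSq hη hcl hξ x)
          have := not_lt.mp hx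
          gcongr
      simp [h3]

/-- The integrated form of the monotonicity inequality. -/
theorem Varifold.mul_localMass_le {n : ℕ} {U : Set (E n)} (hUo : IsOpen U) (hconv : Convex ℝ U)
    (V : Varifold n U) {g : BilinField n} (hg : IsMetricOn U g)
    {η : ℝ} (hη0 : 0 < η) (hη : η < 1) (hcl : C1CloseToEuclid U g η) {b : ℝ} (hb : 0 ≤ b)
    (hV : V.HasBoundedFirstVariation g b) {ξ : E n} (hξ : ξ ∈ U) {φ : ℝ → ℝ}
    (hφ : IsProfile φ) {h : E n → ℝ} (hh : ContDiff ℝ 1 h) (h0 : ∀ x, 0 ≤ h x)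
    (hc : HasCompactSupport h) (hU : tsupport h ⊆ U) {t : ℝ} (ht : 0 < t) (ht1 : t ≤ 1) :
    n * V.localMass g η ξ φ h t
      ≤ b * ((1 + η) * t * V.localMass g η ξ φ h t)
        + (1 + (η / (1 - η) + (η / (1 - η)) ^ 2) * t) * t * V.localMassDeriv g η ξ φ h t
        + (1 + 2 * η) / (1 - η) * t * V.ballGrad ξ h t
        + 3 / 2 * n * (η / (1 - η)) * t * V.localMass g η ξ φ h t := by
  have hf := contDiff_localized g η ξ hφ hh t
  have i1 := V.integrable_localized g η ξ hφ hh hc hU t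
  have i2 := (V.hasDerivAt_localMass hη hcl hξ hφ hh h0 hc hU ht).1
  have i3 := V.integrable_ballGrad ξ hh hc hU t
  -- Integrability is essential: it identifies the first variation with the integral of the
  -- pointwise divergence that is split off below.
  have i4 : Integrable (fun p : U × Gr n =>
      divergence g (fun z => localized g η ξ φ h t z • (z - ξ)) p.1 p.2) V.measure := by
    refine V.integrable_of_continuous
      (continuous_divergence hUo hg (hf.smul (contDiff_id.sub contDiff_const))) hc hU fun p hp => ?_
    obtain ⟨T, -, Γ, -, -, h1⟩ := exists_divergence_smul_eq hg hη hcl ξ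
      (hf.differentiable one_ne_zero p.1) p.1.2 p.2
    have hp' := fun h' => hp (tsupport_localized_subset g η ξ φ h t h')
    rw [h1, fderiv_of_notMem_tsupport ℝ hp', image_eq_zero_of_notMem_tsupport hp']
    simp
  have key := integral_mono (i1.const_mul (n : ℝ))
    (((i4.add (i2.const_mul ((1 + (η / (1 - η) + (η / (1 - η)) ^ 2) * t) * t))).add
      (i3.const_mul ((1 + 2 * η) / (1 - η) * t))).add
      (i1.const_mul (3 / 2 * n * (η / (1 - η)) * t)))
    (fun p => mul_localized_le hUo hconv hg hη0 hη hcl hφ hh h0 hξ ht ht1 p.1.2 p.2)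
  rw [integral_add' ((i4.add (i2.const_mul _)).add (i3.const_mul _)) (i1.const_mul _),
    integral_add' (i4.add (i2.const_mul _)) (i3.const_mul _),
    integral_add' i4 (i2.const_mul _)] at key
  simp only [integral_const_mul] at key
  have hfv := V.firstVariation_le hη0 hη hcl hb hV hξ hφ hh h0 hc hU ht
  unfold Varifold.firstVariation at hfv
  unfold Varifold.localMassDeriv Varifold.ballGrad
  unfold Varifold.localMass at hfv ⊢
  linarith

/-! ### Integration of the differential inequality in the radius -/

/-- The almost monotonicity of the weighted density ratio. -/
theorem Varifold.exp_mul_localMass_le {n : ℕ} {U : Set (E n)} (hUo : IsOpen U) (hconv : Convex ℝ U)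
    (V : Varifold n U) {g : BilinField n} (hg : IsMetricOn U g)
    {η : ℝ} (hη0 : 0 < η) (hη : η < 1) (hcl : C1CloseToEuclid U g η) {b : ℝ} (hb : 0 ≤ b)
    (hV : V.HasBoundedFirstVariation g b) {ξ : E n} (hξ : ξ ∈ U) {φ : ℝ → ℝ}
    (hφ : IsProfile φ) {h : E n → ℝ} (hh : ContDiff ℝ 1 h) (h0 : ∀ x, 0 ≤ h x)
    (hc : HasCompactSupport h) (hU : tsupport h ⊆ U) {s ρ γ : ℝ} (hs : 0 < s) (hsρ : s ≤ ρ)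
    (hρ : ρ ≤ 1) (hγ : γ = b * (1 + η) + 3 / 2 * n * (η / (1 - η))
      + n * (η / (1 - η) + (η / (1 - η)) ^ 2)) :
    Real.exp (γ * s) / s ^ n * V.localMass g η ξ φ h s
      ≤ Real.exp (γ * ρ) / ρ ^ n * V.localMass g η ξ φ h ρ
        + Real.exp (γ * ρ) * ((1 + 2 * η) / (1 - η)) * ∫ t in s..ρ, V.ballGrad ξ h t / t ^ n := by
  have hη' : 0 < 1 - η := by linarith
  have hγ0 : 0 ≤ γ := by rw [hγ]; positivity
  have hW : ∀ t, 0 < t → Real.exp (γ * t - n * Real.log t) = Real.exp (γ * t) / t ^ n := by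
    intro t ht
    rw [Real.exp_sub, ← Real.log_pow, Real.exp_log (by positivity)]
  -- The minus sign turns the lower bound on the growth of the density ratio into an upper bound on
  -- a derivative. The comparison below then needs integrability of the bounding function only, and
  -- `ballGrad` is monotone.
  have hd : ∀ t, 0 < t → HasDerivAt
      (fun t => -(Real.exp (γ * t - n * Real.log t) * V.localMass g η ξ φ h t))
      (Real.exp (γ * t - n * Real.log t) * (n * V.localMass g η ξ φ h t / t
        - γ * V.localMass g η ξ φ h t - V.localMassDeriv g η ξ φ h t)) t := by
    intro t ht
    have h1 : HasDerivAt (fun t => Real.exp (γ * t - n * Real.log t))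
        (Real.exp (γ * t - n * Real.log t) * (γ * 1 - n * t⁻¹)) t :=
      (((hasDerivAt_id t).const_mul γ).sub ((Real.hasDerivAt_log ht.ne').const_mul _)).exp
    have h2 := (h1.mul (V.hasDerivAt_localMass hη hcl hξ hφ hh h0 hc hU ht).2).neg
    refine h2.congr_deriv ?_
    field_simp
    ring
  have key := intervalIntegral.sub_le_integral_of_hasDeriv_right_of_le
    (φ := fun t => Real.exp (γ * ρ) * ((1 + 2 * η) / (1 - η)) * (V.ballGrad ξ h t / t ^ n)) hsρ
    (fun t ht => (hd t (hs.trans_le ht.1)).continuousAt.continuousWithinAt)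
    (fun t ht => (hd t (hs.trans ht.1)).hasDerivWithinAt) ?_ ?_
  · rw [intervalIntegral.integral_const_mul, hW s hs, hW ρ (hs.trans_le hsρ)] at key
    linarith
  · refine Integrable.const_mul ?_ _
    have h1 : IntegrableOn (V.ballGrad ξ h) (Icc s ρ) :=
      ((V.ballGrad_mono ξ hh hc hU).monotoneOn _).integrableOn_isCompact isCompact_Icc
    have h2 : ContinuousOn (fun t : ℝ => (t ^ n)⁻¹) (Icc s ρ) :=
      (continuousOn_pow n).inv₀ fun t ht => (pow_pos (hs.trans_le ht.1) n).ne'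
    exact (h1.mul_continuousOn h2 isCompact_Icc).congr_fun (fun t _ => (div_eq_mul_inv _ _).symm)
      measurableSet_Icc
  · intro t ht
    have ht0 : 0 < t := hs.trans ht.1
    have ht1 : t ≤ 1 := ht.2.le.trans hρ
    have hm := V.mul_localMass_le hUo hconv hg hη0 hη hcl hb hV hξ hφ hh h0 hc hU ht0 ht1
    have hF0 : 0 ≤ V.localMass g η ξ φ h t :=
      integral_nonneg fun p => mul_nonneg (h0 _) (hφ.nonneg _)
    have hD0 : 0 ≤ V.localMassDeriv g η ξ φ h t := by
      refine integral_nonneg fun p => mul_nonneg (h0 _) ?_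
      refine mul_nonneg_of_nonpos_of_nonpos hφ.antitone.deriv_nonpos ?_
      have := (sq_nonneg _).trans (sq_norm_le_radialSq hη hcl hξ (p.1 : E n))
      rw [neg_mul, neg_div]
      exact neg_nonpos.mpr (by positivity)
    have hJ0 := V.ballGrad_nonneg ξ h t
    have hL0 : 0 < (1 + 2 * η) / (1 - η) := div_pos (by linarith) hη'
    have hκ0 : 0 < η / (1 - η) := div_pos hη0 hη'
    have hWt : Real.exp (γ * t - n * Real.log t) ≤ Real.exp (γ * ρ) / t ^ n := by
      rw [hW t ht0]
      have := ht.2.le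
      gcongr
    have hcore : n * V.localMass g η ξ φ h t / t - γ * V.localMass g η ξ φ h t
        - V.localMassDeriv g η ξ φ h t ≤ (1 + 2 * η) / (1 - η) * V.ballGrad ξ h t := by
      set F := V.localMass g η ξ φ h t
      set D := V.localMassDeriv g η ξ φ h t
      set κ := η / (1 - η)
      set G := (1 + 2 * η) / (1 - η) * V.ballGrad ξ h t with hG
      have hG0 : 0 ≤ G := by positivity
      set q := n * F / t with hq
      have hq0 : 0 ≤ q := by positivity
      have hqt : q * t = n * F := div_mul_cancel₀ _ ht0.ne'
      set m := (κ + κ ^ 2) * t with hm'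
      have hm0 : 0 ≤ m := by positivity
      set β := b * (1 + η) + 3 / 2 * n * κ with hβ
      have hβ0 : 0 ≤ β := by positivity
      -- The last summand of `γ` is chosen for this: since `q t = n F`, it pays exactly for the loss
      -- `m q`.
      have h1 : γ * F = β * F + m * q := by rw [hγ, hm']; linear_combination -(κ + κ ^ 2) * hqt
      have h2 : q ≤ β * F + (1 + m) * D + G := by
        refine le_of_mul_le_mul_right ?_ ht0
        rw [hqt]
        refine hm.trans (le_of_eq ?_)
        rw [hβ, hG]
        ring
      -- This is division by `1 + m` in the form `1 / (1 + m) ≥ 1 - m`: otherwise `(1 + m) D < (1 -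
      -- m²) q - (1 + m) (β F + G) ≤ q - β F - G`, against `h2`.
      by_contra hlt
      have h3 : D < q - β * F - m * q - G := by linarith
      have h4 := mul_lt_mul_of_pos_left h3 (show 0 < 1 + m by linarith)
      have h5 : 0 ≤ m * (β * F + G) := by positivity
      have h6 : 0 ≤ m ^ 2 * q := by positivity
      linarith
    calc _ ≤ Real.exp (γ * t - n * Real.log t) * ((1 + 2 * η) / (1 - η) * V.ballGrad ξ h t) :=
          mul_le_mul_of_nonneg_left hcore (Real.exp_pos _).le
      _ ≤ Real.exp (γ * ρ) / t ^ n * ((1 + 2 * η) / (1 - η) * V.ballGrad ξ h t) := by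
          gcongr
      _ = _ := by ring

/-! ### The constants and their limits -/

/-- The dilation factor: it bounds the anisotropy of a metric that is `η`-close to the Euclidean
one. -/
def dilation (η : ℝ) : ℝ := (1 + 2 * η) / (1 - η)

/-- The increment by which `b` is enlarged in the exponential weight. -/
def rateError (n : ℕ) (η : ℝ) : ℝ :=
  3 / 2 * n * (η / (1 - η)) + n * (η / (1 - η) + (η / (1 - η)) ^ 2)

/-- The excess of the constant and of the radius on the right-hand side. -/
def radiusError (n : ℕ) (η : ℝ) : ℝ := (1 + η) * dilation η ^ (n + 1) - 1

theorem one_le_dilation {η : ℝ} (hη0 : 0 < η) (hη : η < 1) : 1 ≤ dilation η := by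
  rw [dilation, le_div_iff₀ (by linarith)]; linarith

theorem rateError_nonneg (n : ℕ) {η : ℝ} (hη0 : 0 < η) (hη : η < 1) : 0 ≤ rateError n η := by
  have : 0 < η / (1 - η) := div_pos hη0 (by linarith)
  unfold rateError
  positivity

theorem one_add_le_one_add_radiusError (n : ℕ) {η : ℝ} (hη0 : 0 < η) (hη : η < 1) :
    1 + η ≤ 1 + radiusError n η := by
  have := one_le_pow₀ (one_le_dilation hη0 hη) (n := n + 1)
  unfold radiusError
  nlinarith

theorem dilation_pow_le (n : ℕ) {η : ℝ} (hη0 : 0 < η) (hη : η < 1) :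
    dilation η ^ (n + 1) ≤ 1 + radiusError n η := by
  have := one_le_pow₀ (one_le_dilation hη0 hη) (n := n + 1)
  unfold radiusError
  nlinarith

theorem tendsto_radiusError (n : ℕ) : Tendsto (radiusError n) (𝓝[>] 0) (𝓝 0) := by
  have h : ContinuousAt (radiusError n) 0 := by
    unfold radiusError dilation
    fun_prop (disch := norm_num)
  have h2 := h.tendsto.mono_left (nhdsWithin_le_nhds (s := Ioi 0))
  simpa [radiusError, dilation] using h2

theorem tendsto_rateError (n : ℕ) : Tendsto (rateError n) (𝓝[>] 0) (𝓝 0) := by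
  have h : ContinuousAt (rateError n) 0 := by
    unfold rateError
    fun_prop (disch := norm_num)
  have h2 := h.tendsto.mono_left (nhdsWithin_le_nhds (s := Ioi 0))
  simpa [rateError] using h2

theorem tendstoUniformlyOn_of_forall_eq {f : ℝ → ℝ} {F : ℝ → ℝ → ℝ} {l : Filter ℝ} {s : Set ℝ}
    (hf : Tendsto f l (𝓝 0)) (hF : ∀ η b, |F η b| = |f η|) :
    TendstoUniformlyOn F (fun _ => 0) l s := by
  rw [Metric.tendstoUniformlyOn_iff]
  intro ε hε
  filter_upwards [Metric.tendsto_nhds.mp hf ε hε] with η h b _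
  rw [dist_comm, Real.dist_eq, sub_zero, hF]
  rwa [Real.dist_eq, sub_zero] at h

/-! ### From ellipsoids to Euclidean balls -/

/-- A smooth nonnegative function on the ball of radius `3` agrees on the ball of radius `2` with
one that has compact support in the ball of radius `3`. -/
theorem exists_compactSupport_eqOn {n : ℕ} {h : E n → ℝ} (hh : ContDiffOn ℝ ∞ h (ball 0 3))
    (h0 : ∀ x ∈ ball (0 : E n) 3, 0 ≤ h x) :
    ∃ k : E n → ℝ, ContDiff ℝ 1 k ∧ (∀ x, 0 ≤ k x) ∧ HasCompactSupport k ∧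
      tsupport k ⊆ ball 0 3 ∧ EqOn k h (ball 0 2) := by
  let χ : ContDiffBump (0 : E n) := ⟨2, 5 / 2, by norm_num, by norm_num⟩
  have hsub : tsupport (fun x => χ x * h x) ⊆ closedBall 0 (5 / 2) :=
    tsupport_mul_subset_left.trans χ.tsupport_eq.subset
  have hsub3 : closedBall (0 : E n) (5 / 2) ⊆ ball 0 3 := closedBall_subset_ball (by norm_num)
  refine ⟨fun x => χ x * h x, ?_, ?_, ?_, hsub.trans hsub3, ?_⟩
  · rw [contDiff_iff_contDiffAt]
    intro x
    by_cases hx : x ∈ tsupport fun x => χ x * h x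
    -- Off the topological support the product vanishes near `x`; on it, `x` lies in the ball of
    -- radius `3`, where `h` is smooth.
    swap
    · exact contDiffAt_const.congr_of_eventuallyEq
        (notMem_tsupport_iff_eventuallyEq.mp hx : _ =ᶠ[𝓝 x] fun _ => (0 : ℝ))
    have hx3 := hsub3 (hsub hx)
    exact χ.contDiffAt.mul ((hh.contDiffAt (isOpen_ball.mem_nhds hx3)).of_le (by norm_cast))
  · intro x
    by_cases hx : x ∈ ball (0 : E n) 3
    · exact mul_nonneg χ.nonneg (h0 x hx)
    · have := image_eq_zero_of_notMem_tsupport fun h' => hx (hsub3 (hsub h'))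
      exact this.ge
  · exact χ.hasCompactSupport.mul_right
  · intro x hx
    have : χ x = 1 := χ.one_of_mem_closedBall (ball_subset_closedBall hx)
    simp [this]

theorem tangentialGradNorm_congr {n : ℕ} {k h : E n → ℝ} {s : Set (E n)} (hs : IsOpen s)
    (hkh : EqOn k h s) {x : E n} (hx : x ∈ s) (S : Gr n) :
    tangentialGradNorm k x S = tangentialGradNorm h x S := by
  have : k =ᶠ[𝓝 x] h := hkh.eventuallyEq_of_mem (hs.mem_nhds hx)
  rw [tangentialGradNorm, tangentialGradNorm, gradient, gradient, this.fderiv_eq]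

theorem Varifold.lintegral_mass {n : ℕ} {U : Set (E n)} (V : Varifold n U) {f : E n → ℝ}
    (hf : Continuous f) (hf0 : ∀ x, 0 ≤ f x)
    (hi : Integrable (fun p : U × Gr n => f p.1) V.measure) :
    ∫⁻ x, ENNReal.ofReal (f x) ∂V.mass = ENNReal.ofReal (∫ p, f p.1 ∂V.measure) := by
  rw [Varifold.mass, lintegral_map hf.measurable.ennreal_ofReal (measurable_base n U),
    ofReal_integral_eq_lintegral_ofReal hi (Eventually.of_forall fun _ => hf0 _)]

/-- One inequality is enough for the right-hand side, and in this direction it needs no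
integrability. The gradients of `k` and `h` agree since the functions agree on an open set. -/
theorem Varifold.ofReal_ballGrad_div_le {n : ℕ} {U : Set (E n)} (V : Varifold n U) {ξ : E n}
    {k h : E n → ℝ} {t : ℝ} (ht : 0 ≤ t) {s : Set (E n)} (hs : IsOpen s)
    (hkh : EqOn k h s) (hts : ball ξ t ⊆ s) :
    ENNReal.ofReal (V.ballGrad ξ k t / t ^ n)
      ≤ ∫⁻ p in {p | (p.1 : E n) ∈ ball ξ t},
          ENNReal.ofReal (tangentialGradNorm h (p.1 : E n) p.2 / t ^ n) ∂V.measure := by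
  have hm : MeasurableSet {p : U × Gr n | (p.1 : E n) ∈ ball ξ t} :=
    measurable_base n U measurableSet_ball
  rw [Varifold.ballGrad, ← integral_div, ← lintegral_indicator hm]
  refine (Real.ofReal_le_enorm _).trans ((enorm_integral_le_lintegral_enorm _).trans
    (lintegral_mono fun p => ?_))
  by_cases hp : (p.1 : E n) ∈ ball ξ t
  · rw [indicator_of_mem hp, indicator_of_mem (by exact hp),
      tangentialGradNorm_congr hs hkh (hts hp), Real.enorm_of_nonneg]
    exact div_nonneg (norm_nonneg _) (pow_nonneg ht n)
  · simp [indicator_of_notMem hp]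

/-- The almost monotonicity with weight and with explicit constants. -/
theorem Varifold.weighted_monotonicity {n : ℕ} {η : ℝ} (hη0 : 0 < η) (hη : η < 1) {b : ℝ}
    (hb : 0 ≤ b) {g : BilinField n} (hg : IsMetricOn (ball 0 3) g)
    (hcl : C1CloseToEuclid (ball 0 3) g η) (V : Varifold n (ball 0 3))
    (hV : V.HasBoundedFirstVariation g b) {ξ : E n} (hξ : ξ ∈ ball (0 : E n) 1) {σ ρ : ℝ}
    (hσ : 0 < σ) (hσρ : σ ≤ ρ) (hρ : ρ < 1) {h : E n → ℝ} (hh : ContDiffOn ℝ ∞ h (ball 0 3))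
    (h0 : ∀ x ∈ ball (0 : E n) 3, 0 ≤ h x) {a c : ℝ} (ha : a = radiusError n η)
    (hc : c = b + rateError n η) :
    ENNReal.ofReal (Real.exp (c * σ) / σ ^ n) * ∫⁻ x in ball ξ σ, ENNReal.ofReal (h x) ∂V.mass
      ≤ ENNReal.ofReal ((1 + a) * Real.exp (c * (1 + a) * ρ))
        * (ENNReal.ofReal (1 / ρ ^ n)
            * ∫⁻ x in ball ξ ((1 + a) * ρ), ENNReal.ofReal (h x) ∂V.mass
          + ∫⁻ τ in Ioc σ ((1 + a) * ρ),
              ∫⁻ p in {p | (p.1 : E n) ∈ ball ξ τ},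
                ENNReal.ofReal (tangentialGradNorm h (p.1 : E n) p.2 / τ ^ n) ∂V.measure) := by
  have hρ0 : 0 < ρ := hσ.trans_le hσρ
  have hL1 := one_le_dilation hη0 hη
  have hε := rateError_nonneg n hη0 hη
  have ha1 : 1 + η ≤ 1 + a := ha ▸ one_add_le_one_add_radiusError n hη0 hη
  have haL : dilation η ^ (n + 1) ≤ 1 + a := ha ▸ dilation_pow_le n hη0 hη
  have haL' : dilation η ^ n ≤ 1 + a := (pow_le_pow_right₀ hL1 n.le_succ).trans haL
  have hc0 : 0 ≤ c := by linarith
  have hρa : ρ ≤ (1 + a) * ρ := le_mul_of_one_le_left hρ0.le (by linarith)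
  have hcρ : c * σ ≤ c * (1 + a) * ρ := by
    rw [mul_assoc]; exact mul_le_mul_of_nonneg_left (hσρ.trans hρa) hc0
  set L := dilation η with hL
  -- The ellipsoid of size `L * σ` can exceed size `ρ`. Then the radii are comparable, `ρ ^ n ≤ L ^
  -- n * σ ^ n`, and inclusion of balls suffices.
  by_cases hcase : ρ < L * σ
  · have h1 : Real.exp (c * σ) / σ ^ n ≤ (1 + a) * Real.exp (c * (1 + a) * ρ) * (1 / ρ ^ n) := by
      have h2 : ρ ^ n ≤ (1 + a) * σ ^ n := calc
        ρ ^ n ≤ (L * σ) ^ n := by gcongr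
        _ = L ^ n * σ ^ n := mul_pow _ _ _
        _ ≤ _ := by gcongr
      rw [mul_one_div, div_le_div_iff₀ (by positivity) (by positivity)]
      calc Real.exp (c * σ) * ρ ^ n
          ≤ Real.exp (c * (1 + a) * ρ) * ((1 + a) * σ ^ n) := by gcongr
        _ = _ := by ring
    calc _ ≤ ENNReal.ofReal ((1 + a) * Real.exp (c * (1 + a) * ρ) * (1 / ρ ^ n))
          * ∫⁻ x in ball ξ ((1 + a) * ρ), ENNReal.ofReal (h x) ∂V.mass := by
          gcongr
          exact hσρ.trans hρa
      _ = ENNReal.ofReal ((1 + a) * Real.exp (c * (1 + a) * ρ)) * (ENNReal.ofReal (1 / ρ ^ n)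
          * ∫⁻ x in ball ξ ((1 + a) * ρ), ENNReal.ofReal (h x) ∂V.mass) := by
          rw [ENNReal.ofReal_mul (mul_nonneg (by linarith) (Real.exp_pos _).le), mul_assoc]
      _ ≤ _ := by gcongr; exact le_self_add
  · have hLσ := not_lt.mp hcase
    have hs0 : 0 < L * σ := by positivity
    have hσL : σ ≤ L * σ := le_mul_of_one_le_left hσ.le hL1
    have hξ3 : ξ ∈ ball (0 : E n) 3 := ball_subset_ball (by norm_num) hξ
    have hball2 : ∀ t ≤ ρ, ball ξ t ⊆ ball (0 : E n) 2 := by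
      intro t ht x hx
      rw [mem_ball] at hx hξ ⊢
      linarith [dist_triangle x ξ 0]
    obtain ⟨k, hk, hk0, hkc, hkU, hkh⟩ := exists_compactSupport_eqOn hh h0
    -- The `2 * η` in `dilation` leaves this gap: on `ball ξ σ` the quotient `radialSq / (L * σ) ^
    -- 2` is at most `(1 + η) / (1 + 2 * η)`, so a fixed smooth profile equals `1` there and no
    -- limit of profiles is needed.
    have hθ : (1 + η) / (1 + 2 * η) < 1 := by
      rw [div_lt_one (by linarith)]; linarith
    obtain ⟨φ, hφ, hφ1⟩ := exists_isProfile hθ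
    set γ := b * (1 + η) + 3 / 2 * n * (η / (1 - η)) + n * (η / (1 - η) + (η / (1 - η)) ^ 2)
      with hγ
    have hγe : γ = b * (1 + η) + rateError n η := by rw [hγ, rateError]; ring
    have main := V.exp_mul_localMass_le isOpen_ball (convex_ball _ _) hg hη0 hη hcl hb hV hξ3 hφ
      hk hk0 hkc hkU hs0 hLσ hρ.le hγ
    change _ ≤ _ + _ * L * _ at main
    set I := ∫ t in (L * σ)..ρ, V.ballGrad ξ k t / t ^ n with hI
    have hmass : ∀ t, ∫⁻ x, ENNReal.ofReal (localized g η ξ φ k t x) ∂V.mass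
        = ENNReal.ofReal (V.localMass g η ξ φ k t) := fun t =>
      V.lintegral_mass (contDiff_localized g η ξ hφ hk t).continuous
        (fun x => mul_nonneg (hk0 x) (hφ.nonneg _)) (V.integrable_localized g η ξ hφ hk hkc hkU t)
    have left : ∫⁻ x in ball ξ σ, ENNReal.ofReal (h x) ∂V.mass
        ≤ ENNReal.ofReal (V.localMass g η ξ φ k (L * σ)) := by
      rw [← hmass, ← lintegral_indicator measurableSet_ball]
      refine lintegral_mono fun x => ?_
      by_cases hx : x ∈ ball ξ σ
      · rw [indicator_of_mem hx, localized, hφ1, mul_one, hkh (hball2 σ hσρ hx)]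
        rw [mem_ball, dist_eq_norm] at hx
        rw [div_le_iff₀ (by positivity)]
        calc radialSq g η ξ x ≤ (1 + η) / (1 - η) * ‖x - ξ‖ ^ 2 := radialSq_le hη hcl hξ3 x
          _ ≤ (1 + η) / (1 - η) * σ ^ 2 := by
            have : 0 < 1 - η := by linarith
            gcongr
          _ = (1 + η) / (1 + 2 * η) * (L * σ ^ 2) := by
            have : 1 - η ≠ 0 := by linarith
            rw [hL, dilation]
            field_simp
          _ ≤ (1 + η) / (1 + 2 * η) * (L * L * σ ^ 2) := by
            gcongr
            exact le_mul_of_one_le_left (by positivity) hL1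
          _ = _ := by ring
      · simp [indicator_of_notMem hx]
    have right : ENNReal.ofReal (V.localMass g η ξ φ k ρ)
        ≤ ∫⁻ x in ball ξ ((1 + a) * ρ), ENNReal.ofReal (h x) ∂V.mass := by
      rw [← hmass, ← lintegral_indicator measurableSet_ball]
      refine lintegral_mono fun x => ?_
      by_cases hx : x ∈ ball ξ ρ
      · rw [indicator_of_mem (ball_subset_ball hρa hx), localized]
        refine ENNReal.ofReal_le_ofReal ?_
        rw [← hkh (hball2 ρ le_rfl hx)]
        exact mul_le_of_le_one_right (hk0 x) (hφ.le_one _)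
      · have h1 : 1 ≤ radialSq g η ξ x / ρ ^ 2 := by
          rw [le_div_iff₀ (by positivity), one_mul]
          refine le_trans ?_ (sq_norm_le_radialSq hη hcl hξ3 x)
          rw [mem_ball, dist_eq_norm, not_lt] at hx
          gcongr
        simp [localized, hφ.eq_zero _ h1]
    have grad : ENNReal.ofReal I ≤ ∫⁻ τ in Ioc σ ((1 + a) * ρ),
        ∫⁻ p in {p | (p.1 : E n) ∈ ball ξ τ},
          ENNReal.ofReal (tangentialGradNorm h (p.1 : E n) p.2 / τ ^ n) ∂V.measure := by
      rw [hI, intervalIntegral.integral_of_le hLσ]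
      refine (Real.ofReal_le_enorm _).trans ((enorm_integral_le_lintegral_enorm _).trans ?_)
      refine le_trans (setLIntegral_mono' measurableSet_Ioc fun t ht => ?_)
        (lintegral_mono_set (Ioc_subset_Ioc hσL hρa))
      have ht0 : 0 < t := hs0.trans ht.1
      rw [Real.enorm_of_nonneg (div_nonneg (V.ballGrad_nonneg ξ k t) (by positivity))]
      exact V.ofReal_ballGrad_div_le ht0.le isOpen_ball hkh (hball2 t ht.2)
    have hFσ : 0 ≤ V.localMass g η ξ φ k (L * σ) :=
      integral_nonneg fun p => mul_nonneg (hk0 _) (hφ.nonneg _)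
    have hFρ : 0 ≤ V.localMass g η ξ φ k ρ :=
      integral_nonneg fun p => mul_nonneg (hk0 _) (hφ.nonneg _)
    have hI0 : 0 ≤ I := intervalIntegral.integral_nonneg hLσ fun t ht =>
      div_nonneg (V.ballGrad_nonneg ξ k t) (pow_nonneg (hs0.le.trans ht.1) n)
    have real : Real.exp (c * σ) / σ ^ n * V.localMass g η ξ φ k (L * σ)
        ≤ (1 + a) * Real.exp (c * (1 + a) * ρ) * (1 / ρ ^ n * V.localMass g η ξ φ k ρ + I) := by
      -- The rate `γ` has `b * (1 + η)` where `c` has `b`. The chain `c ≤ γ ≤ c * (1 + η) ≤ c * (1 +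
      -- a)` moves the surplus into the factor `1 + a` of the right-hand exponent, so that `c - b`
      -- stays independent of `b`.
      have hcγ : c ≤ γ := by rw [hγe, hc]; nlinarith
      have e1 : c * σ ≤ γ * (L * σ) := mul_le_mul hcγ hσL hσ.le (by linarith)
      have e2 : γ * ρ ≤ c * (1 + a) * ρ := by
        refine mul_le_mul_of_nonneg_right ?_ hρ0.le
        calc γ ≤ c * (1 + η) := by rw [hγe, hc]; nlinarith
          _ ≤ c * (1 + a) := by gcongr
      calc Real.exp (c * σ) / σ ^ n * V.localMass g η ξ φ k (L * σ)
          ≤ Real.exp (γ * (L * σ)) / σ ^ n * V.localMass g η ξ φ k (L * σ) := by gcongr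
        _ = L ^ n * (Real.exp (γ * (L * σ)) / (L * σ) ^ n * V.localMass g η ξ φ k (L * σ)) := by
          rw [mul_pow]; field_simp
        _ ≤ L ^ n * (Real.exp (γ * ρ) / ρ ^ n * V.localMass g η ξ φ k ρ
            + Real.exp (γ * ρ) * L * I) := by gcongr
        _ = Real.exp (γ * ρ) * (L ^ n * (1 / ρ ^ n * V.localMass g η ξ φ k ρ)
            + L ^ (n + 1) * I) := by ring
        _ ≤ Real.exp (c * (1 + a) * ρ) * ((1 + a) * (1 / ρ ^ n * V.localMass g η ξ φ k ρ)
            + (1 + a) * I) := by gcongr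
        _ = _ := by ring
    calc _ ≤ ENNReal.ofReal (Real.exp (c * σ) / σ ^ n)
          * ENNReal.ofReal (V.localMass g η ξ φ k (L * σ)) := by gcongr
      _ = ENNReal.ofReal (Real.exp (c * σ) / σ ^ n * V.localMass g η ξ φ k (L * σ)) :=
          (ENNReal.ofReal_mul (by positivity)).symm
      _ ≤ ENNReal.ofReal
          ((1 + a) * Real.exp (c * (1 + a) * ρ) * (1 / ρ ^ n * V.localMass g η ξ φ k ρ + I)) :=
          ENNReal.ofReal_le_ofReal real
      _ = ENNReal.ofReal ((1 + a) * Real.exp (c * (1 + a) * ρ)) * (ENNReal.ofReal (1 / ρ ^ n)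
          * ENNReal.ofReal (V.localMass g η ξ φ k ρ) + ENNReal.ofReal I) := by
          rw [ENNReal.ofReal_mul (mul_nonneg (by linarith) (Real.exp_pos _).le),
            ENNReal.ofReal_add (by positivity) hI0,
            ENNReal.ofReal_mul (p := 1 / ρ ^ n) (by positivity)]
      _ ≤ _ := by gcongr

end

end VarifoldMonotonicity

/-! ### The theorem -/

open VarifoldMonotonicity in
theorem mainTheorem8 (n : ℕ) :
    ∃ a c : ℝ → ℝ → ℝ,
      (∀ η ∈ Ioo (0 : ℝ) 1, ∀ b : ℝ, 0 ≤ b →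
        0 ≤ a η b ∧ 0 ≤ c η b ∧
        ∀ g : BilinField n, IsMetricOn (ball 0 3) g → C1CloseToEuclid (ball 0 3) g η →
        ∀ V : Varifold n (ball 0 3), V.HasBoundedFirstVariation g b →
        ∀ ξ ∈ ball (0 : E n) 1, ∀ σ ρ : ℝ, 0 < σ → σ ≤ ρ → ρ < 1 →
          (ENNReal.ofReal (Real.exp (c η b * σ) / σ ^ n) * V.mass (ball ξ σ)
            ≤ ENNReal.ofReal ((1 + a η b) * Real.exp (c η b * (1 + a η b) * ρ) / ρ ^ n)
                * V.mass (ball ξ ((1 + a η b) * ρ))) ∧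
          (∀ h : E n → ℝ, ContDiffOn ℝ ∞ h (ball 0 3) → (∀ x ∈ ball (0 : E n) 3, 0 ≤ h x) →
            ENNReal.ofReal (Real.exp (c η b * σ) / σ ^ n)
                * ∫⁻ x in ball ξ σ, ENNReal.ofReal (h x) ∂V.mass
              ≤ ENNReal.ofReal ((1 + a η b) * Real.exp (c η b * (1 + a η b) * ρ))
                * (ENNReal.ofReal (1 / ρ ^ n)
                    * ∫⁻ x in ball ξ ((1 + a η b) * ρ), ENNReal.ofReal (h x) ∂V.mass
                  + ∫⁻ τ in Ioc σ ((1 + a η b) * ρ),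
                      ∫⁻ p in {p | (p.1 : E n) ∈ ball ξ τ},
                        ENNReal.ofReal (tangentialGradNorm h (p.1 : E n) p.2 / τ ^ n)
                          ∂V.measure))) ∧
      TendstoUniformlyOn a (fun _ => 0) (𝓝[>] 0) (Ici 0) ∧
      TendstoUniformlyOn (fun η b => |c η b - b|) (fun _ => 0) (𝓝[>] 0) (Ici 0) := by
  -- Neither `a` nor `c - b` depends on `b`, so uniformity in `b` reduces to a limit in `η` alone.
  refine ⟨fun η _ => radiusError n η, fun η b => b + rateError n η, ?_,
    tendstoUniformlyOn_of_forall_eq (tendsto_radiusError n) fun _ _ => rfl,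
    tendstoUniformlyOn_of_forall_eq (tendsto_rateError n) fun _ _ => by simp⟩
  rintro η ⟨hη0, hη⟩ b hb
  have ha := one_add_le_one_add_radiusError n hη0 hη
  refine ⟨by linarith, add_nonneg hb (rateError_nonneg n hη0 hη), ?_⟩
  intro g hg hcl V hV ξ hξ σ ρ hσ hσρ hρ
  refine ⟨?_, fun h hh h0 => V.weighted_monotonicity hη0 hη hb hg hcl hV hξ hσ hσρ hρ hh h0 rfl rfl⟩
  -- The unweighted inequality is the case of the constant weight `1`, whose tangential gradient
  -- vanishes.
  have h1 := V.weighted_monotonicity hη0 hη hb hg hcl hV hξ hσ hσρ hρ (h := fun _ => 1)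
    contDiffOn_const (fun _ _ => zero_le_one) rfl rfl
  have h2 : ∀ (x : E n) (S : Gr n), tangentialGradNorm (fun _ => (1 : ℝ)) x S = 0 := by
    simp [tangentialGradNorm, gradient]
  simp only [h2, zero_div, ENNReal.ofReal_zero, lintegral_zero, add_zero, ENNReal.ofReal_one,
    setLIntegral_one] at h1
  rwa [← mul_assoc, ← ENNReal.ofReal_mul (mul_nonneg (by linarith) (Real.exp_pos _).le),
    mul_one_div] at h1
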